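/- **Setting.** Let $V_{\mathbb R}$ be a finite-dimensional real vector space, $w\in\mathbb Z$, and $Q$ a nondegenerate $(-1)^w$-symmetric bilinear form on $V_{\mathbb R}$. Let $F_0$ be a $Q$-polarized Hodge structure of weight $w$ on $V_{\mathbb R}$ (with $i^{p-q}Q(v,\bar v)>0$ for $0\ne v\in H^{p,q}$), and let $G_{\mathbb R}\subset \mathrm{Aut}(V_{\mathbb R},Q)$ be a subgroup containing the image of the circle $\varphi\colon S^1\to \mathrm{Aut}(V_{\mathbb R},Q)$, where $\varphi(z)$ acts on $H^{p,q}$ as $z^{p-q}$, such that $\mathfrak g_{\mathbb R}=\{X\in\mathrm{End}(V_{\mathbb R}) \mid \exp(tX)\in G_{\mathbb R}\ \forall t\in\mathbb R\}$ is a Lie algebra (this is automatic if $G_{\mathbb R}$ is closed). Put $D=G_{\mathbb R}\cdot F_0$. (If $G_{\mathbb R}=\mathrm{Aut}(V_{\mathbb R},Q)$, then $D$ is a period domain; if $G_{\mathbb R}$ is the group of real points of the Mumford–Tate group of $F_0$, then $D$ is a Mumford–Tate domain.) Let $(F;N_1,\dots,N_m)$ be a nilpotent orbit on $D$: $F$ is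 a filtration of $V_{\mathbb C}$, the $N_i\in\mathfrak g_{\mathbb R}$ are commuting nilpotent endomorphisms with $N_iF^p\subset F^{p-1}$, and $\exp(\sum_i z_iN_i)F\in D$ whenever all $\mathrm{Im}\,z_i$ are sufficiently large. For $0\le j\le m$ let $\sigma_j=\{\sum_{i\le j}t_iN_i \mid t_i>0\}$, so that $\sigma=\sigma_m$ is the nilpotent cone, and let $W(\sigma_j)$ denote the common monodromy weight filtration, centred at $0$, of all elements of $\sigma_j$. Assume that the limit mixed Hodge structure $(F,W(\sigma)[-w])$ is $\mathbb R$-split, with Deligne bigrading $V_{\mathbb C}=\bigoplus V^{p,q}$. Let $\mathfrak g^{p,q}=\{X\in\mathfrak g_{\mathbb C}\mid XV^{a,b}\subset V^{a+p,b+q}\ \forall a,b\}$, $\mathfrak m_{\mathbb C}=\bigoplus_p\mathfrak g^{p,p}$, $\mathfrak m_{\mathbb R}=\mathfrak m_{\mathbb C}\cap\mathfrak g_{\mathbb R}$ and $\mathfrak m_{\mathbb R}^{\mathrm{ss}}=[\mathfrak m_{\mathbb R},\mathfrak m_{\mathbb R}]$. The system of commuting $\mathfrak{sl}(2)$'s attached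 by Cattani, Kaplan and Schmid to $(F;N_1,\dots,N_m)$ consists of (possibly zero) triples $(\hat N_j^+,H_j,\hat N_j)$ in $\mathfrak g_{\mathbb R}$, $1\le j\le m$, with $[H_j,\hat N_j^+]=2\hat N_j^+$, $[\hat N_j^+,\hat N_j]=H_j$, $[H_j,\hat N_j]=-2\hat N_j$. In Deligne's description it is characterized as follows, where $Y^j=w+H_1+\dots+H_j$: the endomorphism $Y^m$ acts on $V^{p,q}$ as $p+q$; each $Y^j$ is a grading of $W(\sigma_j)[-w]$ (it is semisimple with integral eigenvalues, and the $k$-th step of the filtration is the sum of the eigenspaces with eigenvalue at most $k$); $Y^{j-1}$ commutes with $Y^j$; $\hat N_j$ is the component of $N_j$ of degree $0$ with respect to $\mathrm{ad}\,Y^{j-1}$; and $[N_j-\hat N_j,\hat N_j^+]=0$. The real rank of a semisimple real Lie algebra is the largest dimension of a subspace of $\mathfrak p$ consisting of commuting semisimple elements, where $\mathfrak k\oplus\mathfrak p$ is a Cartan decomposition of the algebra. **Lemma 3.11.** The number of indices $j$ for which the triple $(\hat N_j^+,H_j,\hat N_j)$ is nonzero, that is, the number of nontrivial commuting $\mathfrak{sl}(2)$'s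 attached to the nilpotent orbit, is at most the real rank of $\mathfrak m_{\mathbb R}^{\mathrm{ss}}$. -/

import Mathlib

open Matrix

attribute [local instance 100] LieRing.ofAssociativeRing

noncomputable section

namespace NilpotentCone

/-! ### Real structures

A finite-dimensional real vector space is taken as `V_ℝ = ι → ℝ` for a finite type `ι` (a basis is
chosen); then `V_ℂ = ι → ℂ`, with complex conjugation acting coordinatewise. -/

section RealStructure

variable {ι : Type*}

/-- The complexification of a real endomorphism. -/
def cplx (A : Matrix ι ι ℝ) : Matrix ι ι ℂ := A.map (fun x : ℝ => (x : ℂ))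

/-- The complexification `U_ℂ ⊆ V_ℂ` of a real subspace `U ⊆ V_ℝ`. -/
def cplxSubspace (U : Submodule ℝ (ι → ℝ)) : Submodule ℂ (ι → ℂ) :=
  Submodule.span ℂ ((fun (v : ι → ℝ) (i : ι) => (v i : ℂ)) '' (U : Set (ι → ℝ)))

/-- The complex conjugate of a subspace of `V_ℂ`. -/
def conjSubspace (U : Submodule ℂ (ι → ℂ)) : Submodule ℂ (ι → ℂ) where
  carrier := {v | star v ∈ U}
  add_mem' {u v} hu hv := by
    simp only [Set.mem_ofPred_eq, star_add] at *
    exact U.add_mem hu hv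
  zero_mem' := by simp
  smul_mem' c v hv := by
    simp only [Set.mem_ofPred_eq, star_smul] at *
    exact U.smul_mem _ hv

end RealStructure

/-! ### Hodge structures and Hodge domains -/

section Hodge

variable {ι : Type*} [Fintype ι] [DecidableEq ι]

/-- The complex bilinear extension to `V_ℂ` of the form on `V_ℝ` with Gram matrix `Q`. -/
def formC (Q : Matrix ι ι ℝ) (u v : ι → ℂ) : ℂ := u ⬝ᵥ (cplx Q *ᵥ v)

/-- The translate `A · F` of a filtration of `V_ℂ`. -/
def translate (A : Matrix ι ι ℂ) (F : ℤ → Submodule ℂ (ι → ℂ)) : ℤ → Submodule ℂ (ι → ℂ) :=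
  fun p => (F p).map A.mulVecLin

/-- The Hodge component `H^{p,w-p} = F^p ∩ conj F^{w-p}`. -/
def hodgeComponent (w : ℤ) (F : ℤ → Submodule ℂ (ι → ℂ)) (p : ℤ) : Submodule ℂ (ι → ℂ) :=
  F p ⊓ conjSubspace (F (w - p))

/-- `F` is the Hodge filtration of a (real) Hodge structure of weight `w` polarized by `Q`. -/
structure IsPolarizedHodge (w : ℤ) (Q : Matrix ι ι ℝ) (F : ℤ → Submodule ℂ (ι → ℂ)) : Prop where
  antitone : Antitone F
  exists_top : ∃ p, F p = ⊤
  exists_bot : ∃ p, F p = ⊥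
  opposed : ∀ p, IsCompl (F p) (conjSubspace (F (w + 1 - p)))
  isotropic : ∀ p, ∀ u ∈ F p, ∀ v ∈ F (w + 1 - p), formC Q u v = 0
  positive : ∀ p, ∀ v ∈ hodgeComponent w F p, v ≠ 0 →
    0 < (Complex.I ^ (p - (w - p)) * formC Q v (star v)).re

variable (ι) in
/-- A Hodge domain `D = G_ℝ · F₀`: the orbit of a polarized Hodge structure `F₀` of weight `w` on
`V_ℝ` under a group `G_ℝ` of automorphisms of `(V_ℝ, Q)` that contains the image of the circle
`φ : S¹ → Aut(V_ℝ, Q)` of `F₀` (where `φ(z)` acts on `H^{p,q}` as `z^{p-q}`).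

`G_ℝ = Aut(V_ℝ, Q)` gives the period domains; the real points `G_ℝ` of the Mumford-Tate group of
`F₀` give the Mumford-Tate domains. The Lie algebra of `G_ℝ` is recorded as `𝔤`. -/
structure HodgeDomain where
  w : ℤ
  Q : Matrix ι ι ℝ
  nondegenerate : IsUnit Q.det
  parity : Qᵀ = ((-1 : ℝ) ^ w) • Q
  F₀ : ℤ → Submodule ℂ (ι → ℂ)
  polarized : IsPolarizedHodge w Q F₀
  G : Subgroup (GL ι ℝ)
  isometry : ∀ g ∈ G, (g : Matrix ι ι ℝ)ᵀ * Q * (g : Matrix ι ι ℝ) = Q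
  circle : ∀ z : ℂ, ‖z‖ = 1 → ∃ g ∈ G, ∀ p, ∀ v ∈ hodgeComponent w F₀ p,
    cplx (g : Matrix ι ι ℝ) *ᵥ v = (z ^ (p - (w - p))) • v
  𝔤 : LieSubalgebra ℝ (Matrix ι ι ℝ)
  mem_𝔤 : ∀ X : Matrix ι ι ℝ,
    X ∈ 𝔤 ↔ ∀ t : ℝ, ∃ g ∈ G, (g : Matrix ι ι ℝ) = NormedSpace.exp (t • X)

/-- The points of the Hodge domain, as Hodge filtrations. -/
def HodgeDomain.points (D : HodgeDomain ι) : Set (ℤ → Submodule ℂ (ι → ℂ)) :=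
  {F | ∃ g ∈ D.G, F = translate (cplx (g : Matrix ι ι ℝ)) D.F₀}

/-- `(F; N₁, …, N_m)` is an `m`-variable nilpotent orbit on `D`. (The last condition forces `F`
to lie in the compact dual `G_ℂ · F₀`, because the operators `exp (∑ zⁱ Nᵢ)` lie in `G_ℂ`.) -/
structure IsNilpotentOrbit (D : HodgeDomain ι) {m : ℕ} (F : ℤ → Submodule ℂ (ι → ℂ))
    (N : Fin m → Matrix ι ι ℝ) : Prop where
  mem : ∀ i, N i ∈ D.𝔤
  nilpotent : ∀ i, IsNilpotent (N i)
  commute : ∀ i j, Commute (N i) (N j)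
  horizontal : ∀ i p, ∀ v ∈ F p, cplx (N i) *ᵥ v ∈ F (p - 1)
  eventually_mem : ∃ c : ℝ, ∀ z : Fin m → ℂ, (∀ i, c < (z i).im) →
    translate (NormedSpace.exp (∑ i, z i • cplx (N i))) F ∈ D.points

end Hodge

/-! ### Monodromy weight filtrations and bigradings -/

section Weight

variable {ι : Type*} [Fintype ι] [DecidableEq ι]

/-- `W` is the monodromy weight filtration of the nilpotent endomorphism `N`, centred at `0`: the
finite increasing filtration with `N W_k ⊆ W_{k-2}` such that `N^l` induces an isomorphism
`Gr_l → Gr_{-l}` for all `l ≥ 0`. -/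
structure IsMonodromyWeightFiltration (N : Matrix ι ι ℝ) (W : ℤ → Submodule ℝ (ι → ℝ)) :
    Prop where
  monotone : Monotone W
  exists_top : ∃ k, W k = ⊤
  exists_bot : ∃ k, W k = ⊥
  lowers : ∀ k, ∀ v ∈ W k, N *ᵥ v ∈ W (k - 2)
  injective : ∀ l : ℕ, ∀ v ∈ W l, (N ^ l) *ᵥ v ∈ W (-(l : ℤ) - 1) → v ∈ W ((l : ℤ) - 1)
  surjective : ∀ l : ℕ, ∀ u ∈ W (-(l : ℤ)), ∃ v ∈ W l, u - (N ^ l) *ᵥ v ∈ W (-(l : ℤ) - 1)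

/-- `W = W_•(σ)` is the weight filtration of the open cone `σ = {∑ tⁱ Nᵢ | tⁱ > 0}`, that is,
the monodromy weight filtration, centred at `0`, of each of its elements. -/
def IsConeWeightFiltration {κ : Type*} [Fintype κ] (N : κ → Matrix ι ι ℝ)
    (W : ℤ → Submodule ℝ (ι → ℝ)) : Prop :=
  ∀ t : κ → ℝ, (∀ i, 0 < t i) → IsMonodromyWeightFiltration (∑ i, t i • N i) W

/-- The shifted filtration `W[-w]`, which is centred at `w` if `W` is centred at `0`. -/
def shift (w : ℤ) (W : ℤ → Submodule ℝ (ι → ℝ)) : ℤ → Submodule ℝ (ι → ℝ) := fun k => W (k - w)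

/-- `(F, W)` is an `ℝ`-split mixed Hodge structure with Deligne bigrading `V_ℂ = ⨁ V^{p,q}`,
where `V^{p,q} = I (p, q)`. -/
structure IsRSplitBigrading (F : ℤ → Submodule ℂ (ι → ℂ)) (W : ℤ → Submodule ℝ (ι → ℝ))
    (I : ℤ × ℤ → Submodule ℂ (ι → ℂ)) : Prop where
  isInternal : DirectSum.IsInternal I
  hodge : ∀ p, F p = ⨆ a : {a : ℤ × ℤ // p ≤ a.1}, I a
  weight : ∀ k, cplxSubspace (W k) = ⨆ a : {a : ℤ × ℤ // a.1 + a.2 ≤ k}, I a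
  conj : ∀ p q, conjSubspace (I (p, q)) = I (q, p)

/-- `Y` is a grading of the filtration `W`: a semisimple endomorphism with integral eigenvalues
such that `W_k` is the sum of the eigenspaces with eigenvalue at most `k`. -/
structure IsGrading (Y : Matrix ι ι ℝ) (W : ℤ → Submodule ℝ (ι → ℝ)) : Prop where
  semisimple : (⨆ l : ℤ, Module.End.eigenspace (Matrix.toLin' Y) (l : ℝ)) = ⊤
  filtration : ∀ k, W k = ⨆ l : {l : ℤ // l ≤ k}, Module.End.eigenspace (Matrix.toLin' Y) (l : ℝ)

end Weight

/-! ### The Levi algebra `𝔪` -/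

section Levi

variable {ι : Type*} [Fintype ι] [DecidableEq ι]

/-- `𝔤_ℂ`, the complexification of the Lie algebra of `G_ℝ`. -/
def HodgeDomain.𝔤ℂ (D : HodgeDomain ι) : Submodule ℂ (Matrix ι ι ℂ) :=
  Submodule.span ℂ (cplx '' (D.𝔤 : Set (Matrix ι ι ℝ)))

/-- The component `𝔤^{p,q}` of the Deligne bigrading of `𝔤_ℂ` induced by the bigrading
`V_ℂ = ⨁ V^{p,q}`: the elements of `𝔤_ℂ` that map `V^{a,b}` to `V^{a+p,b+q}` for all `a, b`. -/
def HodgeDomain.component (D : HodgeDomain ι) (I : ℤ × ℤ → Submodule ℂ (ι → ℂ)) (p q : ℤ) :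
    Submodule ℂ (Matrix ι ι ℂ) where
  carrier := {X | X ∈ D.𝔤ℂ ∧ ∀ a b, ∀ v ∈ I (a, b), X *ᵥ v ∈ I (a + p, b + q)}
  add_mem' := by
    rintro X Y ⟨hX, hX'⟩ ⟨hY, hY'⟩
    refine ⟨add_mem hX hY, fun a b v hv => ?_⟩
    rw [Matrix.add_mulVec]
    exact add_mem (hX' a b v hv) (hY' a b v hv)
  zero_mem' := ⟨zero_mem _, fun a b v _ => by rw [Matrix.zero_mulVec]; exact zero_mem _⟩
  smul_mem' := by
    rintro c X ⟨hX, hX'⟩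
    refine ⟨Submodule.smul_mem _ c hX, fun a b v hv => ?_⟩
    rw [Matrix.smul_mulVec]
    exact Submodule.smul_mem _ c (hX' a b v hv)

/-- `𝔪_ℂ = ⨁_p 𝔤^{p,p}`. -/
def HodgeDomain.𝔪ℂ (D : HodgeDomain ι) (I : ℤ × ℤ → Submodule ℂ (ι → ℂ)) :
    Submodule ℂ (Matrix ι ι ℂ) :=
  ⨆ p : ℤ, D.component I p p

theorem HodgeDomain.lie_mem_𝔤ℂ (D : HodgeDomain ι) {X Y : Matrix ι ι ℂ} (hX : X ∈ D.𝔤ℂ)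
    (hY : Y ∈ D.𝔤ℂ) : X * Y - Y * X ∈ D.𝔤ℂ := by
  induction hX, hY using Submodule.span_induction₂ with
  | mem_mem x y hx hy =>
    obtain ⟨A, hA, rfl⟩ := hx
    obtain ⟨B, hB, rfl⟩ := hy
    refine Submodule.subset_span ⟨⁅A, B⁆, D.𝔤.lie_mem hA hB, ?_⟩
    have hmul : ∀ P R : Matrix ι ι ℝ, cplx (P * R) = cplx P * cplx R := fun P R =>
      Matrix.map_mul (f := Complex.ofRealHom)
    rw [LieRing.of_associative_ring_bracket, ← hmul, ← hmul]
    ext i j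
    simp [cplx]
  | zero_left y hy => simp
  | zero_right x hx => simp
  | add_left x y z _ _ _ h₁ h₂ =>
    have : (x + y) * z - z * (x + y) = (x * z - z * x) + (y * z - z * y) := by noncomm_ring
    rw [this]; exact add_mem h₁ h₂
  | add_right x y z _ _ _ h₁ h₂ =>
    have : x * (y + z) - (y + z) * x = (x * y - y * x) + (x * z - z * x) := by noncomm_ring
    rw [this]; exact add_mem h₁ h₂
  | smul_left r x y _ _ h =>
    rw [smul_mul_assoc, mul_smul_comm, ← smul_sub]; exact Submodule.smul_mem _ r h
  | smul_right r x y _ _ h =>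
    rw [smul_mul_assoc, mul_smul_comm, ← smul_sub]; exact Submodule.smul_mem _ r h

theorem HodgeDomain.lie_mem_𝔪ℂ (D : HodgeDomain ι) (I : ℤ × ℤ → Submodule ℂ (ι → ℂ))
    {X Y : Matrix ι ι ℂ} (hX : X ∈ D.𝔪ℂ I) (hY : Y ∈ D.𝔪ℂ I) : X * Y - Y * X ∈ D.𝔪ℂ I := by
  refine Submodule.iSup_induction (fun p : ℤ => D.component I p p)
    (motive := fun X => X * Y - Y * X ∈ D.𝔪ℂ I) hX ?_ (by simp) ?_
  · intro p X hXp
    refine Submodule.iSup_induction (fun p : ℤ => D.component I p p)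
      (motive := fun Y => X * Y - Y * X ∈ D.𝔪ℂ I) hY ?_ (by simp) ?_
    · intro q Y hYq
      refine Submodule.mem_iSup_of_mem (p + q) ⟨D.lie_mem_𝔤ℂ hXp.1 hYq.1, fun a b v hv => ?_⟩
      rw [Matrix.sub_mulVec, ← Matrix.mulVec_mulVec, ← Matrix.mulVec_mulVec]
      refine sub_mem ?_ ?_
      · have := hXp.2 _ _ _ (hYq.2 a b v hv)
        rwa [add_assoc, add_assoc, add_comm q p] at this
      · have := hYq.2 _ _ _ (hXp.2 a b v hv)
        rwa [add_assoc, add_assoc] at this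
    · intro Y Z h₁ h₂
      have : X * (Y + Z) - (Y + Z) * X = (X * Y - Y * X) + (X * Z - Z * X) := by noncomm_ring
      rw [this]; exact add_mem h₁ h₂
  · intro X Z h₁ h₂
    have : (X + Z) * Y - Y * (X + Z) = (X * Y - Y * X) + (Z * Y - Y * Z) := by noncomm_ring
    rw [this]; exact add_mem h₁ h₂

/-- The real form `𝔪_ℝ = 𝔪_ℂ ∩ 𝔤_ℝ`, a Lie algebra. -/
def HodgeDomain.𝔪 (D : HodgeDomain ι) (I : ℤ × ℤ → Submodule ℂ (ι → ℂ)) :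
    LieSubalgebra ℝ (Matrix ι ι ℝ) where
  carrier := {X | X ∈ D.𝔤 ∧ cplx X ∈ D.𝔪ℂ I}
  add_mem' := by
    rintro X Y ⟨hX, hX'⟩ ⟨hY, hY'⟩
    refine ⟨add_mem hX hY, ?_⟩
    have : cplx (X + Y) = cplx X + cplx Y := by ext i j; simp [cplx]
    rw [this]; exact add_mem hX' hY'
  zero_mem' := by
    refine ⟨zero_mem _, ?_⟩
    have : cplx (0 : Matrix ι ι ℝ) = 0 := by ext i j; simp [cplx]
    rw [this]; exact zero_mem _
  smul_mem' := by
    rintro c X ⟨hX, hX'⟩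
    refine ⟨D.𝔤.smul_mem c hX, ?_⟩
    have : cplx (c • X) = (c : ℂ) • cplx X := by ext i j; simp [cplx]
    rw [this]; exact Submodule.smul_mem _ _ hX'
  lie_mem' := by
    rintro X Y ⟨hX, hX'⟩ ⟨hY, hY'⟩
    refine ⟨D.𝔤.lie_mem hX hY, ?_⟩
    have hmul : ∀ P R : Matrix ι ι ℝ, cplx (P * R) = cplx P * cplx R := fun P R =>
      Matrix.map_mul (f := Complex.ofRealHom)
    have : cplx ⁅X, Y⁆ = cplx X * cplx Y - cplx Y * cplx X := by
      rw [LieRing.of_associative_ring_bracket, ← hmul, ← hmul]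
      ext i j
      simp [cplx]
    rw [this]; exact D.lie_mem_𝔪ℂ I hX' hY'

/-- `𝔪_ℝ^ss = [𝔪_ℝ, 𝔪_ℝ]`. -/
def HodgeDomain.𝔪ss (D : HodgeDomain ι) (I : ℤ × ℤ → Submodule ℂ (ι → ℂ)) :
    LieIdeal ℝ (D.𝔪 I) :=
  ⁅(⊤ : LieIdeal ℝ (D.𝔪 I)), (⊤ : LieIdeal ℝ (D.𝔪 I))⁆

end Levi

/-! ### Cartan decompositions and the real rank -/

section RealRank

variable (L : Type*) [LieRing L] [LieAlgebra ℝ L]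

/-- `L = 𝔨 ⊕ 𝔭` is a Cartan decomposition of the (semisimple) real Lie algebra `L`. -/
structure IsCartanDecomposition (𝔨 𝔭 : Submodule ℝ L) : Prop where
  isCompl : IsCompl 𝔨 𝔭
  lie_𝔨_𝔨 : ∀ x ∈ 𝔨, ∀ y ∈ 𝔨, ⁅x, y⁆ ∈ 𝔨
  lie_𝔨_𝔭 : ∀ x ∈ 𝔨, ∀ y ∈ 𝔭, ⁅x, y⁆ ∈ 𝔭
  lie_𝔭_𝔭 : ∀ x ∈ 𝔭, ∀ y ∈ 𝔭, ⁅x, y⁆ ∈ 𝔨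
  neg : ∀ x ∈ 𝔨, x ≠ 0 → killingForm ℝ L x x < 0
  pos : ∀ x ∈ 𝔭, x ≠ 0 → 0 < killingForm ℝ L x x

/-- The real rank of a semisimple real Lie algebra `L` of finite dimension: the largest dimension
of a subspace of `𝔭` that consists of commuting semisimple elements, for a Cartan decomposition
`L = 𝔨 ⊕ 𝔭`. (All Cartan decompositions are conjugate and give the same number.) -/
def realRank : ℕ :=
  sSup {d : ℕ | ∃ 𝔨 𝔭 : Submodule ℝ L, IsCartanDecomposition L 𝔨 𝔭 ∧
    ∃ 𝔞 : Submodule ℝ L, 𝔞 ≤ 𝔭 ∧ (∀ x ∈ 𝔞, ∀ y ∈ 𝔞, ⁅x, y⁆ = 0) ∧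
      (∀ x ∈ 𝔞, (LieAlgebra.ad ℝ L x).IsSemisimple) ∧ Module.finrank ℝ 𝔞 = d}

end RealRank

/-! ### The `𝔰𝔩(2)`'s of Cattani, Kaplan and Schmid -/

section CKS

/-- A standard triple `{N⁺, Y, N}` (nilpositive, neutral, nilnegative element), that is, a
homomorphism from `𝔰𝔩(2)` to `L`. The zero triple is allowed here. -/
structure StandardTriple (L : Type*) [LieRing L] where
  pos : L
  neut : L
  neg : L
  lie_neut_pos : ⁅neut, pos⁆ = (2 : ℤ) • pos
  lie_pos_neg : ⁅pos, neg⁆ = neut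
  lie_neut_neg : ⁅neut, neg⁆ = (-2 : ℤ) • neg

/-- The triple spans a nonzero subalgebra, which is then a copy of `𝔰𝔩(2)`. -/
def StandardTriple.IsNontrivial {L : Type*} [LieRing L] (T : StandardTriple L) : Prop :=
  T.pos ≠ 0 ∨ T.neut ≠ 0 ∨ T.neg ≠ 0

variable {ι : Type*} [Fintype ι] [DecidableEq ι]

/-- `Y^j = w + H₁ + ⋯ + H_j`, where `H₁, …, H_m` are the neutral elements of the given triples;
so `H_j = Y^j - Y^{j-1}`. (The triples are numbered from `0` here: triple number `k : Fin m` is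
the `(k+1)`-st one.) -/
def gradingOf (D : HodgeDomain ι) {m : ℕ} (T : Fin m → StandardTriple D.𝔤) (j : ℕ) :
    Matrix ι ι ℝ :=
  (D.w : ℝ) • 1 + ∑ k : {k : Fin m // (k : ℕ) < j}, ((T k).neut : Matrix ι ι ℝ)

/-- `T` is the system of `𝔰𝔩(2)`-triples in `𝔤_ℝ` that is attached to the nilpotent orbit
`(F; N₁, …, N_m)` whose limit mixed Hodge structure is `ℝ`-split with Deligne bigrading `I`.

They are described by Deligne's construction: start from the grading `Y^m` that is `p + q` on
`V^{p,q}`. Given `Y^j`, the grading `Y^{j-1}` is the unique grading of the weight filtration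
`W^{j-1}` of the cone of `N₁, …, N_{j-1}` that commutes with `Y^j` and for which the triple
`(N̂_j⁺, H_j, N̂_j)`, where `H_j = Y^j - Y^{j-1}` and `N̂_j` is the component of degree zero of `N_j`
with respect to `ad Y^{j-1}`, satisfies `[N_j - N̂_j, N̂_j⁺] = 0`. These conditions determine `T`. -/
structure IsCKSSystem (D : HodgeDomain ι) {m : ℕ} (N : Fin m → Matrix ι ι ℝ)
    (I : ℤ × ℤ → Submodule ℂ (ι → ℂ)) (T : Fin m → StandardTriple D.𝔤) : Prop where
  top : ∀ p q : ℤ, ∀ v ∈ I (p, q), cplx (gradingOf D T m) *ᵥ v = ((p + q : ℤ) : ℂ) • v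
  grading : ∀ j ≤ m, ∃ W : ℤ → Submodule ℝ (ι → ℝ),
    IsConeWeightFiltration (fun k : {k : Fin m // (k : ℕ) < j} => N k) W ∧
      IsGrading (gradingOf D T j) (shift D.w W)
  commute : ∀ j : Fin m, Commute (gradingOf D T j) (gradingOf D T (j + 1))
  commute_neg : ∀ j : Fin m, Commute (gradingOf D T j) ((T j).neg : Matrix ι ι ℝ)
  sub_neg_mem : ∀ j : Fin m, N j - ((T j).neg : Matrix ι ι ℝ) ∈
    ⨆ c : {c : ℝ // c ≠ 0},
      Module.End.eigenspace (LieAlgebra.ad ℝ (Matrix ι ι ℝ) (gradingOf D T j)) (c : ℝ)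
  lie_pos : ∀ j : Fin m,
    ⁅N j - ((T j).neg : Matrix ι ι ℝ), ((T j).pos : Matrix ι ι ℝ)⁆ = 0

end CKS

end NilpotentCone

end

/-! Let `P` be the operator acting on `V^{p,q}` as `i(p - q)`. It is real because conjugation swaps
`V^{p,q}` and `V^{q,p}`. Splitting by `ad Y^m`-weight shows that `𝔪` is the centralizer of `P` in
`𝔤` (`commute_of_mem_𝔪`, `mem_𝔪_of_commute`), and the rest of the argument rests on this
description.

The triples lie in `𝔪`. Each `N_i` has type (-1,-1), so `P` commutes with all `N_i` and with `Y^m`.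
Deligne's gradings are natural (`lie_eq_smul_of_naturality`): what commutes with all `N_i` and with
`Y^m` commutes with each `Y^j`, hence with each triple. The same naturality shows that the `Y^j`
commute with each other. So the `H_j = [N̂_j⁺, N̂_j]` are commuting real-diagonalizable elements of
`[𝔪, 𝔪]`. Those of the nontrivial triples are independent, since `[H_j, N̂_i] = 0` for `i < j` while
`[H_i, N̂_i] = -2 N̂_i`.

The algebra `𝔪` is stable under a Cartan involution. At a point `exp(∑ z_i N_i) F` of `D`, the Weil
operator `C` lies in `G` and commutes with `P`, the form `Q(C·, ·)` is positive definite, and the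
adjoint of `X ∈ 𝔤` for it is `-C X C⁻¹`. In orthonormal coordinates `𝔪` is thus closed under
transposition (`exists_conj_transpose_closed`), so its derived algebra has trivial centre and splits
into skew and symmetric parts as a Cartan decomposition.

The `H_j` need not be symmetric. Following Kempf and Ness, one minimizes the sum of squares of the
entries on the closure of their conjugation orbit. A minimizer consists of commuting symmetric
elements, and independence survives because characteristic polynomials do
(`exists_symmetric_commuting`). These span the required subspace of `𝔭`. -/

noncomputable section

namespace NilpotentCone

/-! ### Symmetric operators for a positive definite form -/

section PositiveForm

variable {V : Type*} [AddCommGroup V] [Module ℝ V]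

/-- The inner product space structure of a positive definite symmetric bilinear form. -/
@[reducible]
def innerCoreOfForm (B : V →ₗ[ℝ] V →ₗ[ℝ] ℝ) (hsymm : ∀ x y, B x y = B y x)
    (hpos : ∀ x, x ≠ 0 → 0 < B x x) : InnerProductSpace.Core ℝ V where
  inner x y := B x y
  conj_inner_symm x y := by simpa using! hsymm y x
  re_inner_nonneg x := by
    by_cases hx : x = 0
    · simp [hx]
    · simpa using (hpos x hx).le
  add_left x y z := by simp
  smul_left x y r := by simp
  definite x hx := by
    by_contra h
    exact (hpos x h).ne' hx

/-- In an orthonormal basis the trace of `T* T` is the sum of the squared norms of the `T (b i)`.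
This gives the strict signs of the Killing form. -/
theorem trace_comp_adjoint_pos [FiniteDimensional ℝ V] (B : V →ₗ[ℝ] V →ₗ[ℝ] ℝ)
    (hsymm : ∀ x y, B x y = B y x) (hpos : ∀ x, x ≠ 0 → 0 < B x x) (S T : Module.End ℝ V)
    (hST : ∀ x y, B (S x) y = B x (T y)) (hT : T ≠ 0) : 0 < LinearMap.trace ℝ V (S ∘ₗ T) := by
  let c := innerCoreOfForm B hsymm hpos
  let : NormedAddCommGroup V := c.toNormedAddCommGroup
  let : InnerProductSpace ℝ V := InnerProductSpace.ofCore c.toCore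
  let b := stdOrthonormalBasis ℝ V
  have hinner : ∀ x y : V, inner ℝ x y = B x y := fun x y => rfl
  rw [LinearMap.trace_eq_sum_inner _ b]
  have key : ∀ i, inner ℝ (b i) ((S ∘ₗ T) (b i)) = B (T (b i)) (T (b i)) := fun i => by
    rw [hinner, LinearMap.comp_apply, hsymm, hST]
  simp only [key]
  have hnn : ∀ x, 0 ≤ B x x := fun x => by
    by_cases hx : x = 0
    · simp [hx]
    · exact (hpos x hx).le
  obtain ⟨i, hi⟩ : ∃ i, T (b i) ≠ 0 := by
    by_contra! h
    exact hT (b.toBasis.ext fun i => by simpa using h i)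
  exact Finset.sum_pos' (fun i _ => hnn _) ⟨i, Finset.mem_univ _, hpos _ hi⟩

theorem isSemisimple_of_form_symmetric [FiniteDimensional ℝ V] (B : V →ₗ[ℝ] V →ₗ[ℝ] ℝ)
    (hsymm : ∀ x y, B x y = B y x) (hpos : ∀ x, x ≠ 0 → 0 < B x x) (T : Module.End ℝ V)
    (hT : ∀ x y, B (T x) y = B x (T y)) : T.IsSemisimple := by
  let c := innerCoreOfForm B hsymm hpos
  let : NormedAddCommGroup V := c.toNormedAddCommGroup
  let : InnerProductSpace ℝ V := InnerProductSpace.ofCore c.toCore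
  rw [← Module.End.isFinitelySemisimple_iff_isSemisimple]
  exact LinearMap.IsSymmetric.isFinitelySemisimple (fun x y => hT x y)

end PositiveForm

/-! ### Real-diagonalizable matrices -/

section Diagonalizable

variable {ι : Type*} [Fintype ι] [DecidableEq ι]

/-- The matrix is diagonalizable over `ℝ`. -/
def IsRealDiagonalizable (A : Matrix ι ι ℝ) : Prop :=
  ⨆ μ : ℝ, Module.End.eigenspace (Matrix.toLin' A) μ = ⊤

theorem ker_aeval_prod_eq_iSup {V : Type*} [AddCommGroup V] [Module ℝ V] (T : Module.End ℝ V)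
    (s : Finset ℝ) :
    LinearMap.ker (Polynomial.aeval T (∏ μ ∈ s, (Polynomial.X - Polynomial.C μ))) =
      ⨆ μ ∈ s, Module.End.eigenspace T μ := by
  induction s using Finset.induction_on with
  | empty => simp [Module.End.one_eq_id]
  | insert a s ha ih =>
    rw [Finset.prod_insert ha, Finset.iSup_insert, ← ih,
      ← Polynomial.sup_ker_aeval_eq_ker_aeval_mul_of_coprime]
    · congr 1
      ext v
      simp [sub_eq_zero, Algebra.algebraMap_eq_smul_one]
    · refine IsCoprime.prod_right fun i hi => ?_
      exact Polynomial.isCoprime_X_sub_C_of_isUnit_sub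
        (sub_ne_zero.mpr (ne_of_mem_of_not_mem hi ha).symm).isUnit

/-- An annihilating polynomial with distinct real roots expresses diagonalizability as an equation,
which is invariant under conjugation and passes to limits. -/
theorem IsRealDiagonalizable.exists_aeval_eq_zero {A : Matrix ι ι ℝ}
    (hA : IsRealDiagonalizable A) :
    ∃ s : Finset ℝ, Polynomial.aeval A (∏ μ ∈ s, (Polynomial.X - Polynomial.C μ)) = 0 := by
  classical
  have hfin : {μ : ℝ | Module.End.eigenspace (Matrix.toLin' A) μ ≠ ⊥}.Finite :=
    Module.End.finite_hasEigenvalue (Matrix.toLin' A)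
  refine ⟨hfin.toFinset, ?_⟩
  apply (Matrix.toLinAlgEquiv' (R := ℝ) (n := ι)).injective
  rw [map_zero, ← AlgEquiv.coe_toAlgHom, ← Polynomial.aeval_algHom_apply]
  rw [← LinearMap.ker_eq_top]
  refine (ker_aeval_prod_eq_iSup _ _).trans (top_le_iff.mp ?_)
  rw [← hA]
  refine iSup_le fun μ => ?_
  by_cases hμ : Module.End.eigenspace (Matrix.toLin' A) μ = ⊥
  · rw [hμ]; exact bot_le
  · exact le_iSup₂_of_le μ (by simpa using hμ) le_rfl

theorem isRealDiagonalizable_of_aeval_eq_zero {A : Matrix ι ι ℝ} {s : Finset ℝ}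
    (h : Polynomial.aeval A (∏ μ ∈ s, (Polynomial.X - Polynomial.C μ)) = 0) :
    IsRealDiagonalizable A := by
  have h1 := ker_aeval_prod_eq_iSup (Matrix.toLin' A) s
  have h2 : Polynomial.aeval (Matrix.toLin' A) (∏ μ ∈ s, (Polynomial.X - Polynomial.C μ)) = 0 := by
    have := congrArg (Matrix.toLinAlgEquiv' (R := ℝ) (n := ι)) h
    rwa [map_zero, ← AlgEquiv.coe_toAlgHom, ← Polynomial.aeval_algHom_apply] at this
  rw [h2, LinearMap.ker_zero] at h1
  exact top_le_iff.mp (h1.le.trans (iSup₂_le fun μ _ => le_iSup (fun μ : ℝ => _) μ))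

/-- A separable annihilating polynomial makes each operator semisimple, so generalized eigenspaces
are eigenspaces, and commuting operators decompose the space jointly. -/
theorem iSup_iInf_eigenspace_eq_top {κ : Type*} {A : κ → Matrix ι ι ℝ}
    (hA : ∀ i, IsRealDiagonalizable (A i)) (hcomm : ∀ i j, Commute (A i) (A j)) :
    ⨆ χ : κ → ℝ, ⨅ i, Module.End.eigenspace (Matrix.toLin' (A i)) (χ i) = ⊤ := by
  have hss : ∀ i, Module.End.IsFinitelySemisimple (Matrix.toLin' (A i)) := fun i => by
    obtain ⟨s, hs⟩ := (hA i).exists_aeval_eq_zero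
    have h2 : Polynomial.aeval (Matrix.toLin' (A i))
        (∏ μ ∈ s, (Polynomial.X - Polynomial.C μ)) = 0 := by
      have := congrArg (Matrix.toLinAlgEquiv' (R := ℝ) (n := ι)) hs
      rwa [map_zero, ← AlgEquiv.coe_toAlgHom, ← Polynomial.aeval_algHom_apply] at this
    refine (Module.End.isSemisimple_of_squarefree_aeval_eq_zero ?_ h2).isFinitelySemisimple
    exact (Polynomial.separable_prod_X_sub_C_iff' (f := id)).mpr (by simp) |>.squarefree
  have := Module.End.iSup_iInf_maxGenEigenspace_eq_top_of_iSup_maxGenEigenspace_eq_top_of_commute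
    (fun i => Matrix.toLin' (A i)) (fun i j _ => ?_) (fun i => ?_)
  · simpa only [(hss _).maxGenEigenspace_eq_eigenspace] using this
  · have := (hcomm i j).map (Matrix.toLinAlgEquiv' (R := ℝ) (n := ι))
    exact this
  · simp only [(hss _).maxGenEigenspace_eq_eigenspace]
    exact hA i

/-- Two matrices that agree on a family of spanning subspaces are equal. -/
theorem eq_of_mulVec_eq_of_iSup_eq_top {K : Type*} [Field K] {κ : Type*}
    {U : κ → Submodule K (ι → K)} (hU : ⨆ k, U k = ⊤) {A B : Matrix ι ι K}
    (h : ∀ k, ∀ v ∈ U k, A *ᵥ v = B *ᵥ v) : A = B := by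
  apply Matrix.toLin'.injective
  have : ⨆ k, U k ≤ LinearMap.eqLocus (Matrix.toLin' A) (Matrix.toLin' B) :=
    iSup_le fun k v hv => by simpa using h k v hv
  rw [hU] at this
  exact LinearMap.ext fun v => this (Submodule.mem_top (x := v))

end Diagonalizable

/-! ### Conjugation by exponentials -/

section Exponential

section NormedAlgebra

variable {𝔸 : Type*} [NormedRing 𝔸] [NormedAlgebra ℝ 𝔸] [FiniteDimensional ℝ 𝔸]

/-- Left multiplication by `Y` and right multiplication by `-Y` commute, so conjugation by `exp Y`
is `exp (ad Y)`. Its partial sums preserve `𝔩`, and `𝔩` is closed because it is finite-dimensional.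
-/
theorem exp_mul_mul_exp_neg_mem_of_normed {𝔩 : Submodule ℝ 𝔸} {Y : 𝔸}
    (hY : ∀ Z ∈ 𝔩, Y * Z - Z * Y ∈ 𝔩) {Z : 𝔸} (hZ : Z ∈ 𝔩) :
    NormedSpace.exp Y * Z * NormedSpace.exp (-Y) ∈ 𝔩 := by
  have : CompleteSpace 𝔸 := FiniteDimensional.complete ℝ 𝔸
  let L := ContinuousLinearMap.mul ℝ 𝔸 Y
  let R := (ContinuousLinearMap.mul ℝ 𝔸).flip (-Y)
  have hexp : ∀ (T : 𝔸 →L[ℝ] 𝔸) (X : 𝔸),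
      HasSum (fun n : ℕ => ((n.factorial : ℝ)⁻¹) • (T ^ n) X) (NormedSpace.exp T X) :=
    fun T X => by
      have := NormedSpace.exp_series_hasSum_exp' (𝕂 := ℝ) T
      exact this.mapL (ContinuousLinearMap.apply ℝ 𝔸 X)
  have hL : ∀ X, NormedSpace.exp L X = NormedSpace.exp Y * X := fun X => by
    refine (hexp L X).unique ?_
    have hs := (NormedSpace.exp_series_hasSum_exp' (𝕂 := ℝ) Y).mul_right X
    have : ∀ n : ℕ, (L ^ n) X = Y ^ n * X := fun n => by
      induction n with
      | zero => simp
      | succ n ih => rw [pow_succ', pow_succ', mul_apply_eq_comp, ih, mul_assoc]; rfl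
    simpa only [this, smul_mul_assoc] using hs
  have hR : ∀ X, NormedSpace.exp R X = X * NormedSpace.exp (-Y) := fun X => by
    refine (hexp R X).unique ?_
    have hs := (NormedSpace.exp_series_hasSum_exp' (𝕂 := ℝ) (-Y)).mul_left X
    have : ∀ n : ℕ, (R ^ n) X = X * (-Y) ^ n := fun n => by
      induction n with
      | zero => simp
      | succ n ih => rw [pow_succ', pow_succ, mul_apply_eq_comp, ih, ← mul_assoc]; rfl
    simpa only [this, mul_smul_comm] using hs
  have hcomm : Commute L R := by
    ext1 X
    change Y * (X * -Y) = Y * X * -Y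
    rw [mul_assoc]
  have hLR : NormedSpace.exp (L + R) Z = NormedSpace.exp Y * Z * NormedSpace.exp (-Y) := by
    let : NormedAlgebra ℚ (𝔸 →L[ℝ] 𝔸) := NormedAlgebra.restrictScalars ℚ ℝ _
    rw [NormedSpace.exp_add_of_commute hcomm, mul_apply_eq_comp, hL, hR, mul_assoc]
  rw [← hLR]
  have hclosed : IsClosed (𝔩 : Set 𝔸) := 𝔩.closed_of_finiteDimensional
  refine hclosed.mem_of_tendsto (hexp (L + R) Z) (Filter.Eventually.of_forall fun s => ?_)
  refine 𝔩.sum_mem fun n _ => 𝔩.smul_mem _ ?_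
  clear * - hY hZ
  induction n with
  | zero => simpa using hZ
  | succ n ih =>
    rw [pow_succ', mul_apply_eq_comp]
    have : (L + R) (((L + R) ^ n) Z) = Y * (((L + R) ^ n) Z) - (((L + R) ^ n) Z) * Y := by
      change Y * _ + _ * -Y = _
      rw [mul_neg, sub_eq_add_neg]
    rw [this]
    exact hY _ ih

theorem hasDerivAt_exp_smul (Y : 𝔸) :
    HasDerivAt (fun t : ℝ => NormedSpace.exp (t • Y)) Y 0 := by
  have : CompleteSpace 𝔸 := FiniteDimensional.complete ℝ 𝔸
  simpa using hasDerivAt_exp_smul_const (𝕂 := ℝ) Y (0 : ℝ)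

theorem hasDerivAt_map_exp_smul (φ : 𝔸 →ₗ[ℝ] ℝ) (Y : 𝔸) :
    HasDerivAt (fun t : ℝ => φ (NormedSpace.exp (t • Y))) (φ Y) 0 :=
  (LinearMap.toContinuousLinearMap φ).hasFDerivAt.comp_hasDerivAt (0 : ℝ) (hasDerivAt_exp_smul Y)

theorem hasDerivAt_map_exp_mul_mul_exp_neg (φ : 𝔸 →ₗ[ℝ] ℝ) (Y Z : 𝔸) :
    HasDerivAt (fun t : ℝ => φ (NormedSpace.exp (t • Y) * Z * NormedSpace.exp (-(t • Y))))
      (φ (Y * Z - Z * Y)) 0 := by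
  have h1 := hasDerivAt_exp_smul Y
  have h2 := hasDerivAt_exp_smul (-Y)
  have := (h1.mul_const Z).mul h2
  simp only [smul_neg] at this
  have h3 := (LinearMap.toContinuousLinearMap φ).hasFDerivAt.comp_hasDerivAt (0 : ℝ) this
  refine h3.congr_deriv ?_
  change φ _ = φ _
  simp [sub_eq_add_neg]

end NormedAlgebra

variable {ι : Type*} [Fintype ι] [DecidableEq ι]

theorem matrix_exp_mul_exp_neg (X : Matrix ι ι ℝ) :
    NormedSpace.exp X * NormedSpace.exp (-X) = 1 := by
  rw [Matrix.exp_neg, Matrix.mul_nonsing_inv]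
  exact (Matrix.isUnit_iff_isUnit_det _).mp (Matrix.isUnit_exp X)

theorem exp_mul_mul_exp_neg_mem {𝔩 : Submodule ℝ (Matrix ι ι ℝ)} {Y : Matrix ι ι ℝ}
    (hY : ∀ Z ∈ 𝔩, Y * Z - Z * Y ∈ 𝔩) {Z : Matrix ι ι ℝ} (hZ : Z ∈ 𝔩) :
    NormedSpace.exp Y * Z * NormedSpace.exp (-Y) ∈ 𝔩 := by
  let : NormedRing (Matrix ι ι ℝ) := Matrix.linftyOpNormedRing
  let : NormedAlgebra ℝ (Matrix ι ι ℝ) := Matrix.linftyOpNormedAlgebra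
  exact exp_mul_mul_exp_neg_mem_of_normed hY hZ

/-- Composing with a functional makes the curve real-valued, so the statement involves no choice of
norm on matrices. -/
theorem hasDerivAt_map_matrix_exp_smul (φ : Matrix ι ι ℝ →ₗ[ℝ] ℝ) (Y : Matrix ι ι ℝ) :
    HasDerivAt (fun t : ℝ => φ (NormedSpace.exp (t • Y))) (φ Y) 0 := by
  let : NormedRing (Matrix ι ι ℝ) := Matrix.linftyOpNormedRing
  let : NormedAlgebra ℝ (Matrix ι ι ℝ) := Matrix.linftyOpNormedAlgebra
  exact hasDerivAt_map_exp_smul φ Y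

theorem hasDerivAt_map_matrix_exp_mul_mul_exp_neg (φ : Matrix ι ι ℝ →ₗ[ℝ] ℝ)
    (Y Z : Matrix ι ι ℝ) :
    HasDerivAt (fun t : ℝ => φ (NormedSpace.exp (t • Y) * Z * NormedSpace.exp (-(t • Y))))
      (φ (Y * Z - Z * Y)) 0 := by
  let : NormedRing (Matrix ι ι ℝ) := Matrix.linftyOpNormedRing
  let : NormedAlgebra ℝ (Matrix ι ι ℝ) := Matrix.linftyOpNormedAlgebra
  exact hasDerivAt_map_exp_mul_mul_exp_neg φ Y Z

end Exponential

/-! ### Moving commuting real-diagonalizable matrices into symmetric position -/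

section Minimization

variable {ι : Type*} [Fintype ι] [DecidableEq ι] {κ : Type*}

theorem IsRealDiagonalizable.sum_smul [Fintype κ] {A : κ → Matrix ι ι ℝ}
    (hA : ∀ i, IsRealDiagonalizable (A i)) (hcomm : ∀ i j, Commute (A i) (A j)) (c : κ → ℝ) :
    IsRealDiagonalizable (∑ i, c i • A i) := by
  refine top_le_iff.mp ((iSup_iInf_eigenspace_eq_top hA hcomm).ge.trans (iSup_le fun χ => ?_))
  refine le_iSup_of_le (∑ i, c i * χ i) fun v hv => ?_
  simp only [Submodule.mem_iInf, Module.End.mem_eigenspace_iff, Matrix.toLin'_apply] at hv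
  simp only [Module.End.mem_eigenspace_iff, Matrix.toLin'_apply, Matrix.sum_mulVec,
    Matrix.smul_mulVec, hv, Finset.sum_smul, smul_smul]

/-- Without nonzero real eigenvalues, the eigenspaces reduce to the kernel. The hypothesis is
phrased with determinants because they are continuous and conjugation-invariant. -/
theorem IsRealDiagonalizable.eq_zero {A : Matrix ι ι ℝ} (hA : IsRealDiagonalizable A)
    (hdet : ∀ x : ℝ, x ≠ 0 → (x • (1 : Matrix ι ι ℝ) - A).det ≠ 0) : A = 0 := by
  refine eq_of_mulVec_eq_of_iSup_eq_top hA fun μ v hv => ?_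
  rw [Module.End.mem_eigenspace_iff, Matrix.toLin'_apply] at hv
  by_cases hμ : μ = 0
  · rw [hv, hμ, zero_smul, Matrix.zero_mulVec]
  · have : (μ • (1 : Matrix ι ι ℝ) - A) *ᵥ v = 0 := by
      rw [Matrix.sub_mulVec, Matrix.smul_mulVec, Matrix.one_mulVec, hv, sub_self]
    have hv0 : v = 0 := by
      by_contra h
      exact hdet μ hμ (Matrix.exists_mulVec_eq_zero_iff.mp ⟨v, h, this⟩)
    simp [hv0]

theorem mul_aeval_eq_aeval_mul {A X Z : Matrix ι ι ℝ} (h : A * X = Z * A) (p : Polynomial ℝ) :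
    A * Polynomial.aeval X p = Polynomial.aeval Z p * A := by
  induction p using Polynomial.induction_on' with
  | add p q hp hq => simp [mul_add, add_mul, hp, hq]
  | monomial n a =>
    have hn : SemiconjBy A (X ^ n) (Z ^ n) := SemiconjBy.pow_right h n
    simp [Polynomial.aeval_monomial, Algebra.algebraMap_eq_smul_one, hn.eq]

/-- The sum of the squares of the entries of a family of matrices. -/
def sumSquares [Fintype κ] (Z : κ → Matrix ι ι ℝ) : ℝ := ∑ i, ∑ a, ∑ b, (Z i a b) ^ 2

omit [DecidableEq ι] in
theorem exists_sumSquares_minimizer [Fintype κ] {K : Set (κ → Matrix ι ι ℝ)} (hK : IsClosed K)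
    (hne : K.Nonempty) : ∃ Z ∈ K, ∀ Z' ∈ K, sumSquares Z ≤ sumSquares Z' := by
  obtain ⟨H, hH⟩ := hne
  have hcont : Continuous (sumSquares : (κ → Matrix ι ι ℝ) → ℝ) := by
    unfold sumSquares
    refine continuous_finsetSum _ fun i _ => continuous_finsetSum _ fun a _ =>
      continuous_finsetSum _ fun b _ => Continuous.pow ?_ 2
    exact (continuous_apply i).matrix_elem a b
  -- From `x² ≤ s` follows `|x| ≤ s + 1`, so the box of half-width `r` contains the sublevel set.
  set r := sumSquares H + 1
  have hle : ∀ (Z : κ → Matrix ι ι ℝ) i a b, (Z i a b) ^ 2 ≤ sumSquares Z := fun Z i a b => by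
    have h1 := Finset.single_le_sum (f := fun b => (Z i a b) ^ 2) (fun b _ => sq_nonneg _)
      (Finset.mem_univ b)
    have h2 := Finset.single_le_sum (f := fun a => ∑ b, (Z i a b) ^ 2)
      (fun a _ => Finset.sum_nonneg fun b _ => sq_nonneg _) (Finset.mem_univ a)
    have h3 := Finset.single_le_sum (f := fun i => ∑ a, ∑ b, (Z i a b) ^ 2)
      (fun i _ => Finset.sum_nonneg fun a _ => Finset.sum_nonneg fun b _ => sq_nonneg _)
      (Finset.mem_univ i)
    exact h1.trans (h2.trans h3)
  have hbox : IsCompact {Z : κ → Matrix ι ι ℝ | ∀ i a b, Z i a b ∈ Set.Icc (-r) r} := by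
    have := isCompact_univ_pi (ι := κ) (X := fun _ => Matrix ι ι ℝ) (s := fun _ =>
      Set.univ.pi fun _ : ι => Set.univ.pi fun _ : ι => Set.Icc (-r) r) fun i =>
        isCompact_univ_pi fun a => isCompact_univ_pi fun b => isCompact_Icc
    convert this using 1
    ext Z
    exact ⟨fun h i _ a _ b _ => h i a b, fun h i a b => h i trivial a trivial b trivial⟩
  have hcomp : IsCompact (K ∩ {Z | sumSquares Z ≤ sumSquares H}) := by
    refine hbox.of_isClosed_subset (hK.inter (isClosed_le hcont continuous_const)) ?_
    rintro Z ⟨-, hZ⟩ i a b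
    have h1 := (hle Z i a b).trans hZ
    have h0 : 0 ≤ sumSquares H := (sq_nonneg _).trans h1
    refine Set.mem_Icc.mpr (abs_le.mp ?_)
    refine abs_le_of_sq_le_sq (h1.trans ?_) (by positivity)
    simp only [r]
    nlinarith
  obtain ⟨Z, hZ, hmin⟩ := hcomp.exists_isMinOn ⟨H, hH, le_refl (sumSquares H)⟩ hcont.continuousOn
  refine ⟨Z, hZ.1, fun Z' hZ' => ?_⟩
  by_cases h : sumSquares Z' ≤ sumSquares H
  · exact hmin ⟨hZ', h⟩
  · exact le_trans hZ.2 (not_le.mp h).le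

/-- The orbit of a family of matrices under conjugation by the invertible matrices that
normalize `𝔩`. -/
def normalizerOrbit (𝔩 : Submodule ℝ (Matrix ι ι ℝ)) (H : κ → Matrix ι ι ℝ) :
    Set (κ → Matrix ι ι ℝ) :=
  {Z | ∃ A B : Matrix ι ι ℝ, A * B = 1 ∧ (∀ X ∈ 𝔩, A * X * B ∈ 𝔩) ∧ ∀ i, Z i = A * H i * B}

theorem conj_exp_mem_closure_normalizerOrbit {𝔩 : Submodule ℝ (Matrix ι ι ℝ)}
    {H : κ → Matrix ι ι ℝ} {Y : Matrix ι ι ℝ} (hY : ∀ Z ∈ 𝔩, Y * Z - Z * Y ∈ 𝔩)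
    {Z : κ → Matrix ι ι ℝ} (hZ : Z ∈ closure (normalizerOrbit 𝔩 H)) :
    (fun i => NormedSpace.exp Y * Z i * NormedSpace.exp (-Y)) ∈ closure (normalizerOrbit 𝔩 H) := by
  have hcont : Continuous fun (Z : κ → Matrix ι ι ℝ) i =>
      NormedSpace.exp Y * Z i * NormedSpace.exp (-Y) :=
    continuous_pi fun i =>
      (continuous_const.matrix_mul (continuous_apply i)).matrix_mul continuous_const
  refine map_mem_closure hcont hZ ?_
  rintro Z ⟨A, B, hAB, hmem, hZ⟩
  refine ⟨NormedSpace.exp Y * A, B * NormedSpace.exp (-Y), ?_, fun X hX => ?_, fun i => ?_⟩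
  · rw [mul_assoc, ← mul_assoc A, hAB, one_mul, matrix_exp_mul_exp_neg]
  · have := exp_mul_mul_exp_neg_mem hY (hmem X hX)
    simpa only [mul_assoc] using this
  · simp only [hZ, mul_assoc]

/-- Conjugation by `exp (t Y)` stays in the orbit closure, so along this curve the sum of squares
has a minimum at `t = 0`; the sum of traces is half its derivative there. -/
theorem trace_lie_mul_transpose_eq_zero [Fintype κ] {𝔩 : Submodule ℝ (Matrix ι ι ℝ)}
    {H Z : κ → Matrix ι ι ℝ} (hZ : Z ∈ closure (normalizerOrbit 𝔩 H))
    (hmin : ∀ Z' ∈ closure (normalizerOrbit 𝔩 H), sumSquares Z ≤ sumSquares Z')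
    {Y : Matrix ι ι ℝ} (hY : ∀ Z ∈ 𝔩, Y * Z - Z * Y ∈ 𝔩) :
    ∑ i, ((Y * Z i - Z i * Y) * (Z i)ᵀ).trace = 0 := by
  have hderiv : HasDerivAt (fun t : ℝ => sumSquares
      fun i => NormedSpace.exp (t • Y) * Z i * NormedSpace.exp (-(t • Y)))
      (∑ i, ∑ a, ∑ b, 2 * (Z i a b) * ((Y * Z i - Z i * Y) a b)) 0 := by
    unfold sumSquares
    refine HasDerivAt.fun_sum fun i _ => HasDerivAt.fun_sum fun a _ =>
      HasDerivAt.fun_sum fun b _ => ?_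
    have := (hasDerivAt_map_matrix_exp_mul_mul_exp_neg
      (Matrix.entryLinearMap ℝ ℝ a b) Y (Z i)).pow 2
    exact this.congr_deriv (by simp)
  have hloc : IsLocalMin (fun t : ℝ => sumSquares
      fun i => NormedSpace.exp (t • Y) * Z i * NormedSpace.exp (-(t • Y))) 0 := by
    refine Filter.Eventually.of_forall fun t => ?_
    simp only [zero_smul, neg_zero, NormedSpace.exp_zero, one_mul, mul_one]
    refine hmin _ (conj_exp_mem_closure_normalizerOrbit (fun X hX => ?_) hZ)
    rw [smul_mul_assoc, mul_smul_comm, ← smul_sub]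
    exact 𝔩.smul_mem t (hY X hX)
  have h0 := hloc.hasDerivAt_eq_zero hderiv
  have : ∑ i, ∑ a, ∑ b, 2 * (Z i a b) * ((Y * Z i - Z i * Y) a b) =
      2 * ∑ i, ((Y * Z i - Z i * Y) * (Z i)ᵀ).trace := by
    simp only [Matrix.trace, Matrix.diag_apply, Finset.mul_sum, Matrix.mul_apply (N := (Z _)ᵀ),
      Matrix.transpose_apply]
    refine Finset.sum_congr rfl fun i _ => Finset.sum_congr rfl fun a _ =>
      Finset.sum_congr rfl fun b _ => by ring
  rw [this] at h0
  linarith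

/-- Commuting real-diagonalizable matrices whose self-commutators with the transposes cancel are
symmetric. -/
theorem transpose_eq_of_sum_commutator_eq_zero [Fintype κ] {Z : κ → Matrix ι ι ℝ}
    (hZ : ∀ i, IsRealDiagonalizable (Z i)) (hcomm : ∀ i j, Commute (Z i) (Z j))
    (h : ∑ i, (Z i * (Z i)ᵀ - (Z i)ᵀ * Z i) = 0) (i : κ) : (Z i)ᵀ = Z i := by
  refine eq_of_mulVec_eq_of_iSup_eq_top (iSup_iInf_eigenspace_eq_top hZ hcomm) fun χ v hv => ?_
  simp only [Submodule.mem_iInf, Module.End.mem_eigenspace_iff, Matrix.toLin'_apply] at hv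
  -- On a joint eigenvector, `‖Zᵀv - χv‖² = ‖Zᵀv‖² - ‖Zv‖² = ⟨v, [Z, Zᵀ]v⟩`. Summed over `i` the
  -- right side vanishes, hence every square does.
  have hterm : ∀ i, ((Z i)ᵀ *ᵥ v - χ i • v) ⬝ᵥ ((Z i)ᵀ *ᵥ v - χ i • v) =
      v ⬝ᵥ ((Z i * (Z i)ᵀ - (Z i)ᵀ * Z i) *ᵥ v) := fun i => by
    have e1 : (Z i)ᵀ *ᵥ v ⬝ᵥ (Z i)ᵀ *ᵥ v = v ⬝ᵥ ((Z i * (Z i)ᵀ) *ᵥ v) := by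
      rw [← Matrix.mulVec_mulVec, Matrix.dotProduct_mulVec v, ← Matrix.mulVec_transpose]
    have e2 : (Z i)ᵀ *ᵥ v ⬝ᵥ v = χ i * (v ⬝ᵥ v) := by
      rw [Matrix.mulVec_transpose, ← Matrix.dotProduct_mulVec, hv i, dotProduct_smul, smul_eq_mul]
    have e3 : v ⬝ᵥ (((Z i)ᵀ * Z i) *ᵥ v) = χ i * (χ i * (v ⬝ᵥ v)) := by
      rw [← Matrix.mulVec_mulVec, hv i, Matrix.mulVec_smul, dotProduct_smul, dotProduct_comm, e2,
        smul_eq_mul]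
    rw [Matrix.sub_mulVec, dotProduct_sub v, e3, ← e1]
    simp only [sub_dotProduct, dotProduct_sub, smul_dotProduct, dotProduct_smul, smul_eq_mul,
      dotProduct_comm v ((Z i)ᵀ *ᵥ v), e2]
    ring
  have hsum : ∑ i, ((Z i)ᵀ *ᵥ v - χ i • v) ⬝ᵥ ((Z i)ᵀ *ᵥ v - χ i • v) = 0 := by
    simp only [hterm]
    rw [← dotProduct_sum, ← Matrix.sum_mulVec, h, Matrix.zero_mulVec, dotProduct_zero]
  have hnn : ∀ w : ι → ℝ, 0 ≤ w ⬝ᵥ w := fun w => Finset.sum_nonneg fun a _ => mul_self_nonneg _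
  have := (Finset.sum_eq_zero_iff_of_nonneg fun i _ => hnn _).mp hsum i (Finset.mem_univ i)
  rw [dotProduct_self_eq_zero, sub_eq_zero] at this
  rw [this, hv i]

/-- Commuting real-diagonalizable elements of a transpose-closed Lie algebra of matrices have a
limit under conjugation that consists of symmetric matrices. -/
theorem exists_symmetric_commuting [Finite κ] {𝔩 : Submodule ℝ (Matrix ι ι ℝ)}
    (hlie : ∀ X ∈ 𝔩, ∀ Y ∈ 𝔩, X * Y - Y * X ∈ 𝔩) (htr : ∀ X ∈ 𝔩, Xᵀ ∈ 𝔩)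
    {H : κ → Matrix ι ι ℝ} (hmem : ∀ i, H i ∈ 𝔩) (hcomm : ∀ i j, Commute (H i) (H j))
    (hdiag : ∀ i, IsRealDiagonalizable (H i)) (hind : LinearIndependent ℝ H) :
    ∃ Z : κ → Matrix ι ι ℝ, (∀ i, Z i ∈ 𝔩) ∧ (∀ i j, Commute (Z i) (Z j)) ∧
      (∀ i, (Z i)ᵀ = Z i) ∧ LinearIndependent ℝ Z := by
  have := Fintype.ofFinite κ
  have hne : (closure (normalizerOrbit 𝔩 H)).Nonempty :=
    ⟨H, subset_closure ⟨1, 1, by simp, fun X hX => by simpa using hX, by simp⟩⟩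
  -- The orbit is not shown to be closed. The minimizer is taken in its closure, and only properties
  -- cut out by closed conditions are carried over to it.
  obtain ⟨Z, hZ, hmin⟩ := exists_sumSquares_minimizer isClosed_closure hne
  have hcontr : ∀ i, Continuous fun Z : κ → Matrix ι ι ℝ => Z i := fun i => continuous_apply i
  have closed_mem : ∀ {C : Set (κ → Matrix ι ι ℝ)}, IsClosed C → normalizerOrbit 𝔩 H ⊆ C → Z ∈ C :=
    fun hC hsub => closure_minimal hsub hC hZ
  have hinv : ∀ {A B : Matrix ι ι ℝ}, A * B = 1 → B * A = 1 := fun h => mul_eq_one_comm.mp h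
  have hZmem : ∀ i, Z i ∈ 𝔩 := fun i => by
    refine closed_mem (C := {Z | Z i ∈ 𝔩}) ?_ ?_
    · exact (𝔩.closed_of_finiteDimensional).preimage (hcontr i)
    · rintro Z ⟨A, B, -, hAB, hZ⟩
      change Z i ∈ 𝔩
      rw [hZ]
      exact hAB _ (hmem i)
  have hZcomm : ∀ i j, Commute (Z i) (Z j) := fun i j => by
    refine closed_mem (C := {Z | Z i * Z j = Z j * Z i}) ?_ ?_
    · exact isClosed_eq ((hcontr i).matrix_mul (hcontr j)) ((hcontr j).matrix_mul (hcontr i))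
    · rintro Z ⟨A, B, hAB, -, hZ⟩
      have key : ∀ X Y : Matrix ι ι ℝ, A * X * B * (A * Y * B) = A * (X * Y) * B := fun X Y => by
        calc A * X * B * (A * Y * B) = A * X * (B * A) * (Y * B) := by simp only [mul_assoc]
          _ = A * (X * Y) * B := by rw [hinv hAB]; simp only [mul_assoc, one_mul]
      change Z i * Z j = Z j * Z i
      rw [hZ, hZ, key, key, (hcomm i j).eq]
  have hZdiag : ∀ i, IsRealDiagonalizable (Z i) := fun i => by
    obtain ⟨s, hs⟩ := (hdiag i).exists_aeval_eq_zero
    refine isRealDiagonalizable_of_aeval_eq_zero (s := s) ?_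
    refine closed_mem (C := {Z | Polynomial.aeval (Z i)
      (∏ μ ∈ s, (Polynomial.X - Polynomial.C μ)) = 0}) ?_ ?_
    · exact isClosed_eq ((Polynomial.continuous_aeval _).comp (hcontr i)) continuous_const
    · rintro Z ⟨A, B, hAB, -, hZ⟩
      have h1 : A * H i = Z i * A := by rw [hZ, mul_assoc _ B, hinv hAB, mul_one]
      have h2 := mul_aeval_eq_aeval_mul h1 (∏ μ ∈ s, (Polynomial.X - Polynomial.C μ))
      rw [hs, mul_zero] at h2
      change Polynomial.aeval (Z i) _ = 0
      rw [← mul_one (Polynomial.aeval (Z i) _), ← hAB, ← mul_assoc, ← h2, zero_mul]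
  -- The characteristic polynomial of every linear combination is constant on the orbit, hence on
  -- its closure. This replaces conjugacy of `Z` to `H` in the proof of independence.
  have hZdet : ∀ (c : κ → ℝ) (x : ℝ), (x • (1 : Matrix ι ι ℝ) - ∑ i, c i • Z i).det =
      (x • (1 : Matrix ι ι ℝ) - ∑ i, c i • H i).det := fun c x => by
    refine closed_mem (C := {Z | (x • (1 : Matrix ι ι ℝ) - ∑ i, c i • Z i).det =
      (x • (1 : Matrix ι ι ℝ) - ∑ i, c i • H i).det}) ?_ ?_
    · refine isClosed_eq (Continuous.matrix_det ?_) continuous_const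
      exact continuous_const.sub (continuous_finsetSum _ fun i _ => (hcontr i).const_smul (c i))
    · rintro Z ⟨A, B, hAB, -, hZ⟩
      have : x • (1 : Matrix ι ι ℝ) - ∑ i, c i • Z i =
          A * (x • (1 : Matrix ι ι ℝ) - ∑ i, c i • H i) * B := by
        simp only [hZ, mul_sub, sub_mul, Finset.mul_sum, Finset.sum_mul, mul_smul_comm,
          smul_mul_assoc, mul_one, hAB]
      change (x • (1 : Matrix ι ι ℝ) - ∑ i, c i • Z i).det = _
      rw [this, Matrix.det_mul, Matrix.det_mul, mul_right_comm, ← Matrix.det_mul, hAB,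
        Matrix.det_one, one_mul]
  refine ⟨Z, hZmem, hZcomm, ?_, ?_⟩
  -- `Y` is the moment map `∑ [Z_i, Z_iᵀ]`. It is symmetric and lies in `𝔩`, so it is an allowed
  -- direction, and the first-order condition along it reads `tr (Y Yᵀ) = 0`.
  · obtain ⟨Y, hYdef⟩ : ∃ Y, Y = ∑ i, (Z i * (Z i)ᵀ - (Z i)ᵀ * Z i) := ⟨_, rfl⟩
    have hYmem : Y ∈ 𝔩 := hYdef ▸ 𝔩.sum_mem fun i _ => hlie _ (hZmem i) _ (htr _ (hZmem i))
    have h0 := trace_lie_mul_transpose_eq_zero hZ hmin (fun X hX => hlie Y hYmem X hX)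
    have hYT : Yᵀ = Y := by
      simp [hYdef, Matrix.transpose_sum, Matrix.transpose_sub, Matrix.transpose_mul]
    have hYY : (Y * Yᵀ).trace = 0 := by
      rw [← h0, hYT]
      nth_rewrite 2 [hYdef]
      rw [Finset.mul_sum, Matrix.trace_sum]
      refine Finset.sum_congr rfl fun i _ => ?_
      rw [sub_mul, mul_sub, Matrix.trace_sub, Matrix.trace_sub, ← mul_assoc,
        Matrix.mul_assoc (Z i) Y, Matrix.trace_mul_comm (Z i), mul_assoc Y, mul_assoc Y]
    have hY0 : Y = 0 := by
      have := (Matrix.trace_mul_conjTranspose_self_eq_zero_iff (A := Y)).mp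
        (by simpa [Matrix.conjTranspose_eq_transpose_of_trivial] using hYY)
      exact this
    exact transpose_eq_of_sum_commutator_eq_zero hZdiag hZcomm (hYdef ▸ hY0)
  · rw [Fintype.linearIndependent_iff] at hind ⊢
    intro c hc
    -- If `∑ c_i Z_i = 0`, the diagonalizable matrix `∑ c_i H_i` has only the eigenvalue zero, hence
    -- vanishes.
    refine hind c ((IsRealDiagonalizable.sum_smul hdiag hcomm c).eq_zero fun x hx => ?_)
    rw [← hZdet, hc, sub_zero, Matrix.det_smul, Matrix.det_one, mul_one]
    exact pow_ne_zero _ hx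

end Minimization

/-! ### A lower bound for the real rank -/

section RealRankBound

variable {ι : Type*} [Fintype ι] [DecidableEq ι]

theorem le_realRank {L : Type*} [LieRing L] [LieAlgebra ℝ L] [FiniteDimensional ℝ L]
    {𝔨 𝔭 : Submodule ℝ L} (h : IsCartanDecomposition L 𝔨 𝔭) {𝔞 : Submodule ℝ L} (h𝔞 : 𝔞 ≤ 𝔭)
    (hcomm : ∀ x ∈ 𝔞, ∀ y ∈ 𝔞, ⁅x, y⁆ = 0)
    (hss : ∀ x ∈ 𝔞, (LieAlgebra.ad ℝ L x).IsSemisimple) :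
    Module.finrank ℝ 𝔞 ≤ realRank L := by
  -- A supremum of natural numbers is meaningful only for a bounded set; the dimension of `L` is the
  -- bound.
  refine le_csSup ⟨Module.finrank ℝ L, ?_⟩ ⟨𝔨, 𝔭, h, 𝔞, h𝔞, hcomm, hss, rfl⟩
  rintro d ⟨-, -, -, 𝔟, -, -, -, rfl⟩
  exact Submodule.finrank_le 𝔟

omit [DecidableEq ι] in
theorem trace_mul_transpose_pos {A : Matrix ι ι ℝ} (hA : A ≠ 0) : 0 < (A * Aᵀ).trace := by
  have h := Matrix.posSemidef_self_mul_conjTranspose A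
  rw [Matrix.conjTranspose_eq_transpose_of_trivial] at h
  refine lt_of_le_of_ne h.trace_nonneg fun h0 => hA ?_
  apply (Matrix.trace_mul_conjTranspose_self_eq_zero_iff (A := A)).mp
  rw [Matrix.conjTranspose_eq_transpose_of_trivial, ← h0]

/-! ### Transpose-closed faithful representations and their Cartan decomposition. -/

section Representation

variable {L : Type*} [LieRing L] [LieAlgebra ℝ L] (ρ : L →ₗ⁅ℝ⁆ Matrix ι ι ℝ)

/-- The form `tr (ρ(x) ρ(y)ᵀ)`. -/
def transposeForm : L →ₗ[ℝ] L →ₗ[ℝ] ℝ :=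
  LinearMap.mk₂ ℝ (fun x y => (ρ x * (ρ y)ᵀ).trace)
    (by intros; simp [add_mul]) (by intros; simp) (by intros; simp [mul_add]) (by intros; simp)

theorem transposeForm_apply (x y : L) : transposeForm ρ x y = (ρ x * (ρ y)ᵀ).trace := rfl

theorem transposeForm_symm (x y : L) : transposeForm ρ x y = transposeForm ρ y x := by
  rw [transposeForm_apply, transposeForm_apply, ← Matrix.trace_transpose, Matrix.transpose_mul,
    Matrix.transpose_transpose]

theorem transposeForm_pos (hρ : Function.Injective ρ) (x : L) (hx : x ≠ 0) :
    0 < transposeForm ρ x x :=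
  trace_mul_transpose_pos fun h => hx (hρ (by rw [h, map_zero]))

/-- Cyclicity of the trace: transposition of the matrix corresponds to taking the adjoint of `ad x`
for the form. -/
theorem transposeForm_lie {x x' : L} (h : ρ x' = (ρ x)ᵀ) (y z : L) :
    transposeForm ρ ⁅x, y⁆ z = transposeForm ρ y ⁅x', z⁆ := by
  simp only [transposeForm_apply, LieHom.map_lie, h, LieRing.of_associative_ring_bracket,
    Matrix.transpose_sub, Matrix.transpose_mul, Matrix.transpose_transpose, sub_mul, mul_sub,
    Matrix.trace_sub]
  rw [mul_assoc, Matrix.trace_mul_comm (ρ x), mul_assoc, mul_assoc]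

/-- The elements that `ρ` maps to skew-symmetric matrices. -/
def skewPart : Submodule ℝ L where
  carrier := {x | (ρ x)ᵀ = -ρ x}
  add_mem' {x y} hx hy := by
    simp only [Set.mem_ofPred_eq] at *
    rw [map_add, Matrix.transpose_add, hx, hy, neg_add]
  zero_mem' := by simp
  smul_mem' c x hx := by
    simp only [Set.mem_ofPred_eq] at *
    rw [map_smul, Matrix.transpose_smul, hx, smul_neg]

/-- The elements that `ρ` maps to symmetric matrices. -/
def symmPart : Submodule ℝ L where
  carrier := {x | (ρ x)ᵀ = ρ x}
  add_mem' {x y} hx hy := by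
    simp only [Set.mem_ofPred_eq] at *
    rw [map_add, Matrix.transpose_add, hx, hy]
  zero_mem' := by simp
  smul_mem' c x hx := by
    simp only [Set.mem_ofPred_eq] at *
    rw [map_smul, Matrix.transpose_smul, hx]

theorem mem_skewPart {x : L} : x ∈ skewPart ρ ↔ (ρ x)ᵀ = -ρ x := Iff.rfl

theorem mem_symmPart {x : L} : x ∈ symmPart ρ ↔ (ρ x)ᵀ = ρ x := Iff.rfl

/-- The operator `ad x` is skew-adjoint for skew `x` and self-adjoint for symmetric `x`, so up to
sign the Killing form at `x` is `tr ((ad x)* (ad x))`. It is nonzero because a trivial centre makes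
`ad` injective. -/
theorem isCartanDecomposition_skewPart_symmPart [FiniteDimensional ℝ L]
    (hρ : Function.Injective ρ) (htr : ∀ x, ∃ y, ρ y = (ρ x)ᵀ)
    (hcenter : ∀ x : L, (∀ y : L, ⁅x, y⁆ = 0) → x = 0) :
    IsCartanDecomposition L (skewPart ρ) (symmPart ρ) := by
  have had : ∀ x : L, x ≠ 0 → LieAlgebra.ad ℝ L x ≠ 0 := fun x hx h =>
    hx (hcenter x fun y => by simpa using LinearMap.congr_fun h y)
  refine ⟨⟨?_, ?_⟩, ?_, ?_, ?_, ?_, ?_⟩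
  · rw [Submodule.disjoint_def]
    intro x h1 h2
    rw [mem_skewPart] at h1
    rw [mem_symmPart, h1] at h2
    refine hρ ?_
    rw [map_zero]
    ext a b
    have := congrFun (congrFun h2 a) b
    simp only [Matrix.neg_apply] at this
    simp only [Matrix.zero_apply]
    linarith
  · rw [codisjoint_iff, eq_top_iff]
    intro x _
    obtain ⟨y, hy⟩ := htr x
    refine Submodule.mem_sup.mpr ⟨(2⁻¹ : ℝ) • (x - y), ?_, (2⁻¹ : ℝ) • (x + y), ?_, ?_⟩
    · rw [mem_skewPart, map_smul, map_sub, hy]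
      simp [← smul_neg]
    · rw [mem_symmPart, map_smul, map_add, hy]
      simp [add_comm]
    · rw [← smul_add, sub_add_add_cancel, ← two_smul ℝ x, smul_smul]
      norm_num
  · intro x hx y hy
    rw [mem_skewPart] at *
    simp [LieHom.map_lie, LieRing.of_associative_ring_bracket, hx, hy]
  · intro x hx y hy
    rw [mem_skewPart] at hx
    rw [mem_symmPart] at *
    simp [LieHom.map_lie, LieRing.of_associative_ring_bracket, hx, hy]
    abel
  · intro x hx y hy
    rw [mem_symmPart] at hx hy
    rw [mem_skewPart]
    simp [LieHom.map_lie, LieRing.of_associative_ring_bracket, hx, hy]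
  · intro x hx hx0
    have h := trace_comp_adjoint_pos (transposeForm ρ) (transposeForm_symm ρ)
      (transposeForm_pos ρ hρ) (LieAlgebra.ad ℝ L (-x)) (LieAlgebra.ad ℝ L x)
      (fun y z => transposeForm_lie ρ (by rw [map_neg, Matrix.transpose_neg, hx, neg_neg]) y z)
      (had x hx0)
    rw [map_neg, LinearMap.neg_comp, map_neg] at h
    rw [killingForm_apply_apply]
    linarith
  · intro x hx hx0
    rw [killingForm_apply_apply]
    exact trace_comp_adjoint_pos (transposeForm ρ) (transposeForm_symm ρ)
      (transposeForm_pos ρ hρ) _ _ (fun y z => transposeForm_lie ρ hx.symm y z) (had x hx0)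

/-- If the range of a faithful representation of a Lie algebra with trivial centre is closed under
transposition, then the real rank is at least the number of elements of any linearly independent
commuting family of elements that are represented by real-diagonalizable matrices. -/
theorem card_le_realRank (hρ : Function.Injective ρ) (htr : ∀ x, ∃ y, ρ y = (ρ x)ᵀ)
    (hcenter : ∀ x : L, (∀ y : L, ⁅x, y⁆ = 0) → x = 0) {κ : Type*} [Finite κ] {H : κ → L}
    (hcomm : ∀ i j, ⁅H i, H j⁆ = 0) (hdiag : ∀ i, IsRealDiagonalizable (ρ (H i)))
    (hind : LinearIndependent ℝ H) : Nat.card κ ≤ realRank L := by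
  have : FiniteDimensional ℝ L := Module.Finite.of_injective (ρ : L →ₗ[ℝ] Matrix ι ι ℝ) hρ
  have := Fintype.ofFinite κ
  have hker : LinearMap.ker (ρ : L →ₗ[ℝ] Matrix ι ι ℝ) = ⊥ := LinearMap.ker_eq_bot.mpr hρ
  obtain ⟨Z, hZmem, hZcomm, hZsymm, hZind⟩ := exists_symmetric_commuting
    (𝔩 := LinearMap.range (ρ : L →ₗ[ℝ] Matrix ι ι ℝ)) (H := fun i => ρ (H i))
    (by
      rintro _ ⟨x, rfl⟩ _ ⟨y, rfl⟩
      exact ⟨⁅x, y⁆, by simp [LieRing.of_associative_ring_bracket]⟩)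
    (by
      rintro _ ⟨x, rfl⟩
      exact htr x)
    (fun i => ⟨H i, rfl⟩)
    (fun i j => by
      have := congrArg ρ (hcomm i j)
      rwa [LieHom.map_lie, map_zero, LieRing.of_associative_ring_bracket, sub_eq_zero] at this)
    hdiag (hind.map' (ρ : L →ₗ[ℝ] Matrix ι ι ℝ) hker)
  -- The symmetric matrices lie in the range of `ρ`; their preimages span the subspace of `𝔭`, in
  -- place of the original `H i`.
  choose z hz using hZmem
  have hzind : LinearIndependent ℝ z := by
    refine LinearIndependent.of_comp (ρ : L →ₗ[ℝ] Matrix ι ι ℝ) ?_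
    have h : ⇑(ρ : L →ₗ[ℝ] Matrix ι ι ℝ) ∘ z = Z := funext hz
    rw [h]
    exact hZind
  have hle : Submodule.span ℝ (Set.range z) ≤ symmPart ρ := by
    rw [Submodule.span_le]
    rintro _ ⟨i, rfl⟩
    have : ρ (z i) = Z i := hz i
    change (ρ (z i))ᵀ = ρ (z i)
    rw [this, hZsymm]
  have hlie : ∀ i j, ⁅z i, z j⁆ = 0 := fun i j => hρ (by
    have h : ∀ i, ρ (z i) = Z i := hz
    rw [LieHom.map_lie, map_zero, h, h, LieRing.of_associative_ring_bracket, (hZcomm i j).eq,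
      sub_self])
  rw [Nat.card_eq_fintype_card, ← finrank_span_eq_card hzind]
  refine le_realRank (isCartanDecomposition_skewPart_symmPart ρ hρ htr hcenter) hle ?_ ?_
  · intro x hx y hy
    induction hx, hy using Submodule.span_induction₂ with
    | mem_mem x y hx hy =>
      obtain ⟨i, rfl⟩ := hx
      obtain ⟨j, rfl⟩ := hy
      exact hlie i j
    | zero_left => simp
    | zero_right => simp
    | add_left x y z _ _ _ h₁ h₂ => rw [add_lie, h₁, h₂, add_zero]
    | add_right x y z _ _ _ h₁ h₂ => rw [lie_add, h₁, h₂, add_zero]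
    | smul_left r x y _ _ h => rw [smul_lie, h, smul_zero]
    | smul_right r x y _ _ h => rw [lie_smul, h, smul_zero]
  · intro x hx
    exact isSemisimple_of_form_symmetric (transposeForm ρ) (transposeForm_symm ρ)
      (transposeForm_pos ρ hρ) _ fun y z => transposeForm_lie ρ (hle hx).symm y z

end Representation

/-! ### The derived algebra of a transpose-closed Lie algebra of matrices -/

section Derived

variable {L : Type*} [LieRing L] [LieAlgebra ℝ L] (ρ : L →ₗ⁅ℝ⁆ Matrix ι ι ℝ)

theorem exists_mem_derived_transpose (htr : ∀ x, ∃ y, ρ y = (ρ x)ᵀ) {x : L}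
    (hx : x ∈ ⁅(⊤ : LieIdeal ℝ L), (⊤ : LieIdeal ℝ L)⁆) :
    ∃ y ∈ ⁅(⊤ : LieIdeal ℝ L), (⊤ : LieIdeal ℝ L)⁆, ρ y = (ρ x)ᵀ := by
  rw [← LieSubmodule.mem_toSubmodule, LieSubmodule.lieIdeal_oper_eq_linear_span'] at hx
  induction hx using Submodule.span_induction with
  | mem x hx =>
    obtain ⟨a, -, b, -, rfl⟩ := hx
    obtain ⟨a', ha⟩ := htr a
    obtain ⟨b', hb⟩ := htr b
    refine ⟨⁅b', a'⁆, LieSubmodule.lie_mem_lie trivial trivial, ?_⟩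
    simp [LieRing.of_associative_ring_bracket, ha, hb]
  | zero => exact ⟨0, zero_mem _, by simp⟩
  | add x y _ _ h₁ h₂ =>
    obtain ⟨x', hx', hx⟩ := h₁
    obtain ⟨y', hy', hy⟩ := h₂
    exact ⟨x' + y', add_mem hx' hy', by simp [hx, hy]⟩
  | smul c x _ h =>
    obtain ⟨x', hx', hx⟩ := h
    exact ⟨c • x', SMulMemClass.smul_mem c hx', by simp [hx]⟩

/-- With `x'` the transpose of `x`, `‖[x', y]‖² = ⟨y, [x, [x', y]]⟩ = 0` because `[x', y]` is in the
derived algebra. So `x'`, and then likewise `x`, is central in `L`. Then `⟨[a, b], x⟩ = ⟨b, [aᵀ, x]⟩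
= 0`, so `x` is orthogonal to the derived algebra that contains it. -/
theorem eq_zero_of_mem_derived_of_lie_eq_zero (hρ : Function.Injective ρ)
    (htr : ∀ x, ∃ y, ρ y = (ρ x)ᵀ) {x : L} (hx : x ∈ ⁅(⊤ : LieIdeal ℝ L), (⊤ : LieIdeal ℝ L)⁆)
    (hcomm : ∀ y : L, y ∈ ⁅(⊤ : LieIdeal ℝ L), (⊤ : LieIdeal ℝ L)⁆ → ⁅x, y⁆ = 0) : x = 0 := by
  obtain ⟨x', hx', hxx'⟩ := exists_mem_derived_transpose ρ htr hx
  have hxx : ρ x = (ρ x')ᵀ := by rw [hxx', Matrix.transpose_transpose]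
  have hpos : ∀ y, transposeForm ρ y y = 0 → y = 0 := fun y hy => by
    by_contra h
    exact (transposeForm_pos ρ hρ y h).ne' hy
  have hmem : ∀ a b : L, ⁅a, b⁆ ∈ ⁅(⊤ : LieIdeal ℝ L), (⊤ : LieIdeal ℝ L)⁆ := fun a b =>
    LieSubmodule.lie_mem_lie trivial trivial
  have hlie' : ∀ y : L, ⁅x', y⁆ = 0 := fun y => hpos _ (by
    rw [transposeForm_lie ρ hxx, hcomm _ (hmem _ _), map_zero])
  have hlie : ∀ y : L, ⁅x, y⁆ = 0 := fun y => hpos _ (by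
    rw [transposeForm_lie ρ hxx', hlie', map_zero])
  refine hpos x ?_
  have key : ∀ z ∈ ⁅(⊤ : LieIdeal ℝ L), (⊤ : LieIdeal ℝ L)⁆, transposeForm ρ z x = 0 := by
    intro z hz
    rw [← LieSubmodule.mem_toSubmodule, LieSubmodule.lieIdeal_oper_eq_linear_span'] at hz
    induction hz using Submodule.span_induction with
    | mem z hz =>
      obtain ⟨a, -, b, -, rfl⟩ := hz
      obtain ⟨a', ha⟩ := htr a
      rw [transposeForm_lie ρ ha, ← lie_skew, hlie, neg_zero, map_zero]
    | zero => simp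
    | add x y _ _ h₁ h₂ => simp [h₁, h₂]
    | smul c x _ h => simp [h]
  exact key x hx

theorem card_le_realRank_derived (hρ : Function.Injective ρ) (htr : ∀ x, ∃ y, ρ y = (ρ x)ᵀ)
    {κ : Type*} [Finite κ] {H : κ → L}
    (hmem : ∀ i, H i ∈ ⁅(⊤ : LieIdeal ℝ L), (⊤ : LieIdeal ℝ L)⁆)
    (hcomm : ∀ i j, ⁅H i, H j⁆ = 0) (hdiag : ∀ i, IsRealDiagonalizable (ρ (H i)))
    (hind : LinearIndependent ℝ H) :
    Nat.card κ ≤ realRank (⁅(⊤ : LieIdeal ℝ L), (⊤ : LieIdeal ℝ L)⁆ : LieIdeal ℝ L) := by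
  let σ := ρ.comp (LieIdeal.incl ⁅(⊤ : LieIdeal ℝ L), (⊤ : LieIdeal ℝ L)⁆)
  have hσ : ∀ x, σ x = ρ (x : L) := fun x => rfl
  refine card_le_realRank σ (fun x y h => Subtype.ext (hρ h)) (fun x => ?_) (fun x hx => ?_)
    (H := fun i => ⟨H i, hmem i⟩) (fun i j => Subtype.ext (hcomm i j)) hdiag ?_
  · obtain ⟨y, hy, hyx⟩ := exists_mem_derived_transpose ρ htr x.2
    exact ⟨⟨y, hy⟩, hyx⟩
  · exact Subtype.ext (eq_zero_of_mem_derived_of_lie_eq_zero ρ hρ htr x.2 fun y hy =>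
      congrArg Subtype.val (hx ⟨y, hy⟩))
  · refine LinearIndependent.of_comp
      ((LieSubmodule.incl ⁅(⊤ : LieIdeal ℝ L), (⊤ : LieIdeal ℝ L)⁆ : _ →ₗ⁅ℝ, L⁆ L) : _ →ₗ[ℝ] L) ?_
    exact hind

end Derived

end RealRankBound

/-! ### Weight projections -/

section WeightProjections

variable {V : Type*} [AddCommGroup V] [Module ℝ V]

/-- `p` is the system of projections to the eigenspaces of an endomorphism that is diagonalizable
with integral eigenvalues. -/
structure IsWeightProjections (T : Module.End ℝ V) (p : ℤ → Module.End ℝ V) : Prop where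
  apply_mem : ∀ (n : ℤ) v, T (p n v) = (n : ℝ) • p n v
  apply_self : ∀ (n : ℤ) v, T v = (n : ℝ) • v → p n v = v
  apply_ne : ∀ (m n : ℤ) v, T v = (n : ℝ) • v → m ≠ n → p m v = 0
  exists_sum : ∃ s : Finset ℤ, ∑ n ∈ s, p n = 1

theorem exists_isWeightProjections [FiniteDimensional ℝ V] {T : Module.End ℝ V}
    (hT : ⨆ n : ℤ, Module.End.eigenspace T (n : ℝ) = ⊤) : ∃ p, IsWeightProjections T p := by
  classical
  have hind : iSupIndep fun n : ℤ => Module.End.eigenspace T (n : ℝ) :=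
    (Module.End.eigenspaces_iSupIndep T).comp (f := fun n : ℤ => (n : ℝ)) Int.cast_injective
  have hint : DirectSum.IsInternal fun n : ℤ => Module.End.eigenspace T (n : ℝ) :=
    DirectSum.isInternal_submodule_of_iSupIndep_of_iSup_eq_top hind hT
  let : DirectSum.Decomposition fun n : ℤ => Module.End.eigenspace T (n : ℝ) :=
    hint.chooseDecomposition
  let p : ℤ → Module.End ℝ V := fun n => (Module.End.eigenspace T (n : ℝ)).subtype ∘ₗ
    DirectSum.component ℝ ℤ (fun n : ℤ => Module.End.eigenspace T (n : ℝ)) n ∘ₗ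
      (DirectSum.decomposeLinearEquiv fun n : ℤ => Module.End.eigenspace T (n : ℝ)).toLinearMap
  have hp : ∀ n v, p n v = (DirectSum.decompose
    (fun n : ℤ => Module.End.eigenspace T (n : ℝ)) v n : V) := fun n v => rfl
  have hself : ∀ (n : ℤ) v, T v = (n : ℝ) • v → p n v = v := fun n v hv => by
    rw [hp]
    exact DirectSum.decompose_of_mem_same _ (Module.End.mem_eigenspace_iff.mpr hv)
  have hne : ∀ (m n : ℤ) v, T v = (n : ℝ) • v → m ≠ n → p m v = 0 := fun m n v hv hmn => by
    rw [hp]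
    exact DirectSum.decompose_of_mem_ne _ (Module.End.mem_eigenspace_iff.mpr hv) hmn.symm
  refine ⟨p, fun n v => Module.End.mem_eigenspace_iff.mp (SetLike.coe_mem _), hself, hne, ?_⟩
  have hfin : {n : ℤ | Module.End.eigenspace T (n : ℝ) ≠ ⊥}.Finite :=
    (Module.End.finite_hasEigenvalue T).preimage Int.cast_injective.injOn
  refine ⟨hfin.toFinset, LinearMap.ext fun v => ?_⟩
  have hle : ⨆ n : ℤ, Module.End.eigenspace T (n : ℝ) ≤
      LinearMap.eqLocus (∑ n ∈ hfin.toFinset, p n) 1 := by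
    refine iSup_le fun n v hv => ?_
    rw [LinearMap.mem_eqLocus, LinearMap.sum_apply, Module.End.one_apply]
    by_cases hv0 : v = 0
    · simp [hv0]
    · have hn : n ∈ hfin.toFinset := by
        rw [Set.Finite.mem_toFinset]
        exact fun h => hv0 ((Submodule.mem_bot ℝ).mp (h ▸ hv))
      rw [Module.End.mem_eigenspace_iff] at hv
      rw [Finset.sum_eq_single_of_mem n hn fun m _ hm => hne m n v hv hm, hself n v hv]
  rw [hT] at hle
  exact hle (Submodule.mem_top (x := v))

namespace IsWeightProjections

variable {T : Module.End ℝ V} {p : ℤ → Module.End ℝ V}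

theorem ext_of_eigenvectors (hp : IsWeightProjections T p) {V' : Type*} [AddCommGroup V']
    [Module ℝ V'] {f g : V →ₗ[ℝ] V'} (h : ∀ (n : ℤ) v, T v = (n : ℝ) • v → f v = g v) : f = g := by
  obtain ⟨s, hs⟩ := hp.exists_sum
  ext v
  have hv : v = ∑ n ∈ s, p n v := by
    rw [← LinearMap.sum_apply, hs, Module.End.one_apply]
  rw [hv, map_sum, map_sum]
  exact Finset.sum_congr rfl fun n _ => h n _ (hp.apply_mem n v)

theorem apply_shift (hp : IsWeightProjections T p) {S : Module.End ℝ V} {d : ℤ}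
    (hS : ∀ v, T (S v) = S (T v) + (d : ℝ) • S v) (k : ℤ) (v : V) :
    p k (S v) = S (p (k - d) v) := by
  refine LinearMap.congr_fun (f := p k ∘ₗ S) (g := S ∘ₗ p (k - d))
    (hp.ext_of_eigenvectors fun n v hv => ?_) v
  rw [LinearMap.comp_apply, LinearMap.comp_apply]
  have hSv : T (S v) = ((n + d : ℤ) : ℝ) • S v := by
    rw [hS, hv, map_smul, ← add_smul, Int.cast_add]
  by_cases h : k = n + d
  · rw [h, hp.apply_self _ _ hSv, add_sub_cancel_right, hp.apply_self _ _ hv]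
  · rw [hp.apply_ne _ _ _ hSv h, hp.apply_ne _ _ _ hv (fun h' => h (by omega)), map_zero]

theorem apply_comm (hp : IsWeightProjections T p) {S : Module.End ℝ V}
    (hS : ∀ v, T (S v) = S (T v)) (k : ℤ) (v : V) : p k (S v) = S (p k v) := by
  have := hp.apply_shift (S := S) (d := 0) (fun v => by simp [hS]) k v
  rwa [sub_zero] at this

/-- The eigenvalue may be any real number: in `IsCKSSystem` the nonzero weights of `N_j - N̂_j` are
not assumed integral. -/
theorem apply_eq_zero_of_eigenvector (hp : IsWeightProjections T p) {c : ℝ} {n : ℤ} (hc : c ≠ n)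
    {v : V} (hv : T v = c • v) : p n v = 0 := by
  have h1 := hp.apply_comm (S := T) (fun _ => rfl) n v
  rw [hv, map_smul, hp.apply_mem, ← sub_eq_zero, ← sub_smul] at h1
  exact (smul_eq_zero.mp h1).resolve_left (sub_ne_zero.mpr hc)

theorem apply_apply_ne (hp : IsWeightProjections T p) {m n : ℤ} (h : m ≠ n) (v : V) :
    p m (p n v) = 0 :=
  hp.apply_ne m n _ (hp.apply_mem n v) h

theorem eq_sum (hp : IsWeightProjections T p) : ∃ s : Finset ℤ, ∀ v, v = ∑ n ∈ s, p n v := by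
  obtain ⟨s, hs⟩ := hp.exists_sum
  exact ⟨s, fun v => by rw [← LinearMap.sum_apply, hs, Module.End.one_apply]⟩

end IsWeightProjections

end WeightProjections

/-! ### Standard triples and Deligne's gradings -/

section Deligne

variable {L : Type*} [LieRing L] [LieAlgebra ℝ L]

/-- In a representation of `𝔰𝔩(2)`, the operator `e f` is injective on positive weight spaces. -/
theorem eq_zero_of_lie_lie_eq_zero [FiniteDimensional ℝ L] {e h f x : L} (hhe : ⁅h, e⁆ = (2 : ℝ) • e)
    (hef : ⁅e, f⁆ = h) {μ : ℝ} (hμ : 0 < μ) (hx : ⁅h, x⁆ = μ • x) (hefx : ⁅e, ⁅f, x⁆⁆ = 0) :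
    x = 0 := by
  by_contra hx0
  -- The vectors `eⁿ x` have weights `μ + 2n` and never vanish: `f e y = -c y` with `c > 0`, and `c`
  -- grows by the weight of `e y` at each step. Infinitely many weights contradict finite dimension.
  have hne : ∀ n : ℕ, ∃ y : L, y ≠ 0 ∧ ⁅h, y⁆ = (μ + 2 * n) • y ∧
      ∃ c : ℝ, 0 < c ∧ ⁅f, ⁅e, y⁆⁆ = -(c • y) := by
    intro n
    induction n with
    | zero =>
      refine ⟨x, hx0, by simpa using hx, μ, hμ, ?_⟩
      have := leibniz_lie e f x
      rw [hefx, hef, hx] at this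
      exact (neg_eq_of_add_eq_zero_right this.symm).symm
    | succ n ih =>
      obtain ⟨y, hy, hhy, c, hc, hfy⟩ := ih
      have hhey : ⁅h, ⁅e, y⁆⁆ = (μ + 2 * (n + 1 : ℕ)) • ⁅e, y⁆ := by
        rw [leibniz_lie, hhe, hhy, smul_lie, lie_smul, ← add_smul]
        push_cast
        ring_nf
      refine ⟨⁅e, y⁆, fun h0 => ?_, hhey, c + (μ + 2 * (n + 1 : ℕ)), by positivity, ?_⟩
      · rw [h0, lie_zero, zero_eq_neg] at hfy
        exact (smul_ne_zero hc.ne' hy) hfy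
      · have h1 := leibniz_lie e f ⁅e, y⁆
        rw [hef, hhey, hfy, lie_neg, lie_smul] at h1
        rw [add_smul, neg_add, ← sub_eq_add_neg, h1]
        abel
  choose y hy hhy _ using hne
  have hinf : Set.Infinite {ν : ℝ | (LieAlgebra.ad ℝ L h).HasEigenvalue ν} := by
    refine Set.infinite_of_injective_forall_mem (f := fun n : ℕ => μ + 2 * (n : ℝ))
      (fun m n hmn => ?_) fun n => ?_
    · simpa using hmn
    · exact Module.End.hasEigenvalue_of_hasEigenvector (x := y n)
        ⟨Module.End.mem_eigenspace_iff.mpr (hhy n), hy n⟩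
  exact hinf (Module.End.finite_hasEigenvalue _)

theorem eq_zero_of_lie_eq_zero [FiniteDimensional ℝ L] {e h f x : L} (hhe : ⁅h, e⁆ = (2 : ℝ) • e)
    (hef : ⁅e, f⁆ = h) {μ : ℝ} (hμ : 0 < μ) (hx : ⁅h, x⁆ = μ • x) (hfx : ⁅f, x⁆ = 0) : x = 0 :=
  eq_zero_of_lie_lie_eq_zero hhe hef hμ hx (by rw [hfx, lie_zero])

/-- What commutes with the neutral and the nilnegative element of a standard triple commutes with
its nilpositive element. -/
theorem lie_pos_eq_zero [FiniteDimensional ℝ L] {e h f a : L} (hhe : ⁅h, e⁆ = (2 : ℝ) • e)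
    (hef : ⁅e, f⁆ = h) (hha : ⁅h, a⁆ = 0) (hfa : ⁅f, a⁆ = 0) : ⁅e, a⁆ = 0 := by
  refine eq_zero_of_lie_eq_zero hhe hef two_pos (x := ⁅e, a⁆) ?_ ?_
  · rw [leibniz_lie, hhe, hha, lie_zero, add_zero, smul_lie]
  · have hfe : ⁅f, e⁆ = -h := by rw [← lie_skew, hef]
    rw [leibniz_lie, hfa, lie_zero, add_zero, hfe, neg_lie, hha, neg_zero]

/-- Naturality of Deligne's grading `Z`: it is respected by every element that commutes with `N`,
is homogeneous for `Y`, and does not raise `Z`-weights by more than its `Y`-weight. -/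
theorem lie_eq_smul_of_naturality [FiniteDimensional ℝ L] {Y Z e f N A : L} {d : ℤ}
    {p : ℤ → Module.End ℝ L} (hp : IsWeightProjections (LieAlgebra.ad ℝ L Z) p)
    (hZY : ⁅Z, Y⁆ = 0) (hZf : ⁅Z, f⁆ = 0) (hhe : ⁅Y - Z, e⁆ = (2 : ℝ) • e) (hef : ⁅e, f⁆ = Y - Z)
    (hpN : p 0 N = f) (hNe : ⁅N - f, e⁆ = 0) (hN : ∀ l, 0 < l → p l N = 0)
    (hNA : ⁅N, A⁆ = 0) (hYA : ⁅Y, A⁆ = (d : ℝ) • A) (hA : ∀ k, d < k → p k A = 0) :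
    ⁅Z, A⁆ = (d : ℝ) • A := by
  have had : ∀ (n : ℤ) x, ⁅Z, p n x⁆ = (n : ℝ) • p n x := hp.apply_mem
  have hshift : ∀ (x : L) (n k : ℤ), ⁅Z, x⁆ = (n : ℝ) • x → ∀ y, p k ⁅x, y⁆ = ⁅x, p (k - n) y⁆ :=
    fun x n k hx y => hp.apply_shift (S := LieAlgebra.ad ℝ L x) (fun v => by
      simp only [LieAlgebra.ad_apply]
      rw [leibniz_lie, hx, smul_lie, add_comm]) k y
  -- `Z` commutes with `Y - Z` and with `f`, hence with `e`. So `e` has weight zero, and every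
  -- component of `N` of nonzero weight commutes with `e`.
  have hZe : ⁅Z, e⁆ = 0 := by
    rw [← lie_skew, neg_eq_zero]
    refine lie_pos_eq_zero hhe hef ?_ ?_
    · rw [sub_lie, lie_self, sub_zero, ← lie_skew, hZY, neg_zero]
    · rw [← lie_skew, hZf, neg_zero]
  have hshift0 : ∀ (x : L) (k : ℤ), ⁅Z, x⁆ = 0 → ∀ y, p k ⁅x, y⁆ = ⁅x, p k y⁆ := fun x k hx y => by
    have := hshift x 0 k (by simpa using hx) y
    rwa [sub_zero] at this
  have hpf : ∀ k, k ≠ 0 → p k f = 0 := fun k hk => hp.apply_ne k 0 f (by simpa using hZf) hk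
  have heN : ∀ l, l ≠ 0 → ⁅e, p l N⁆ = 0 := fun l hl => by
    have h1 := hshift0 e l hZe (N - f)
    rw [← lie_skew, hNe, neg_zero, map_zero, map_sub, hpf l hl, sub_zero] at h1
    exact h1.symm
  obtain ⟨s, hs⟩ := hp.eq_sum
  -- This is the component of weight `k` of `[N, A] = 0`.
  have hpA : ∀ k, ∑ l ∈ s, ⁅p l N, p (k - l) A⁆ = 0 := fun k => by
    have h1 : ⁅N, A⁆ = ∑ l ∈ s, ⁅p l N, A⁆ := by
      conv_lhs => rw [hs N]
      rw [sum_lie]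
    have h2 := congrArg (p k) h1
    rw [hNA, map_zero, map_sum] at h2
    rw [h2]
    exact Finset.sum_congr rfl fun l _ => (hshift _ l k (had l N) A).symm
  have hterm : ∀ k, (∀ l ∈ s, l ≠ 0 → ⁅e, ⁅p l N, p (k - l) A⁆⁆ = 0) →
      ⁅e, ⁅f, p k A⁆⁆ = 0 := fun k h => by
    have h1 := congrArg (fun x => ⁅e, x⁆) (hpA k)
    simp only [lie_sum, lie_zero] at h1
    rw [← hpN]
    by_cases h0 : (0 : ℤ) ∈ s
    · rw [Finset.sum_eq_single_of_mem 0 h0 h, sub_zero] at h1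
      exact h1
    · have : p 0 N = 0 := by
        rw [hs N, map_sum]
        exact Finset.sum_eq_zero fun l hl => hp.apply_apply_ne (ne_of_mem_of_not_mem hl h0).symm N
      rw [this, zero_lie, lie_zero]
  have hweight : ∀ k, ⁅Y - Z, p k A⁆ = ((d : ℝ) - k) • p k A := fun k => by
    rw [sub_lie, had, ← hshift0 Y k hZY, hYA, map_smul, sub_smul]
  -- In weight `d` only `l = 0` survives: `l > 0` is excluded by `N` and `l < 0` by `A`. As `p d A`
  -- has weight zero for `Y - Z`, it is then killed by `e` as well.
  have hfd : ⁅f, p d A⁆ = 0 := by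
    have h1 := hpA d
    rw [← hpN]
    by_cases h0 : (0 : ℤ) ∈ s
    · rw [Finset.sum_eq_single_of_mem 0 h0, sub_zero] at h1
      · exact h1
      · intro l _ hl
        rcases lt_or_gt_of_ne hl with hl | hl
        · rw [hA (d - l) (by omega), lie_zero]
        · rw [hN l hl, zero_lie]
    · have : p 0 N = 0 := by
        rw [hs N, map_sum]
        exact Finset.sum_eq_zero fun l hl => hp.apply_apply_ne (ne_of_mem_of_not_mem hl h0).symm N
      rw [this, zero_lie]
  have hed : ⁅e, p d A⁆ = 0 :=
    lie_pos_eq_zero hhe hef (by rw [hweight, sub_self, zero_smul]) hfd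
  -- Descending induction on `k < d`. The terms with `l < 0` involve `p (k - l) A` of higher weight,
  -- which is zero unless `k - l = d`, and then `e` commutes with both factors. Thus `e f` kills `p
  -- k A`, whose weight `d - k` for `Y - Z` is positive.
  have hzero : ∀ n : ℕ, ∀ k, d - k ≤ n → k < d → p k A = 0 := by
    intro n
    induction n with
    | zero => intro k h1 h2; omega
    | succ n ih =>
      intro k h1 h2
      refine eq_zero_of_lie_lie_eq_zero hhe hef (μ := (d : ℝ) - k)
        (sub_pos.mpr (by exact_mod_cast h2)) (hweight k) (hterm k fun l _ hl => ?_)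
      rcases lt_or_gt_of_ne hl with hl' | hl'
      · rcases lt_trichotomy (k - l) d with h | h | h
        · rw [ih (k - l) (by push_cast at h1; omega) h, lie_zero, lie_zero]
        · rw [h, leibniz_lie, heN l hl, hed, zero_lie, lie_zero, add_zero]
        · rw [hA _ h, lie_zero, lie_zero]
      · rw [hN l hl', zero_lie, lie_zero]
  have hAd : p d A = A := by
    have h1 : ∀ k, k ≠ d → p k A = 0 := fun k hk => by
      rcases lt_or_gt_of_ne hk with h | h
      · exact hzero (d - k).toNat k (by omega) h
      · exact hA k h
    by_cases h0 : d ∈ s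
    · conv_rhs => rw [hs A, Finset.sum_eq_single_of_mem d h0 fun k _ hk => h1 k hk]
    · have : A = 0 := by
        rw [hs A]
        exact Finset.sum_eq_zero fun k hk => h1 k (fun h => h0 (h ▸ hk))
      rw [this, map_zero]
  have := had d A
  rwa [hAd] at this

end Deligne

/-! ### Weight filtrations and gradings -/

section WeightFiltrations

variable {ι : Type*} [Fintype ι] [DecidableEq ι]

/-- A matrix that commutes with `N` preserves the monodromy weight filtration of `N`. -/
theorem IsMonodromyWeightFiltration.mulVec_mem {N : Matrix ι ι ℝ} {W : ℤ → Submodule ℝ (ι → ℝ)}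
    (hW : IsMonodromyWeightFiltration N W) {X : Matrix ι ι ℝ} (hX : Commute X N) (k : ℤ)
    {v : ι → ℝ} (hv : v ∈ W k) : X *ᵥ v ∈ W k := by
  have hpow : ∀ (l : ℕ) (u : ι → ℝ), X *ᵥ ((N ^ l) *ᵥ u) = (N ^ l) *ᵥ (X *ᵥ u) := fun l u => by
    rw [Matrix.mulVec_mulVec, Matrix.mulVec_mulVec, (hX.pow_right l).eq]
  have hlow : ∀ (l : ℕ) (k : ℤ), ∀ u ∈ W k, (N ^ l) *ᵥ u ∈ W (k - 2 * l) := by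
    intro l
    induction l with
    | zero => intro k u hu; simpa using hu
    | succ l ih =>
      intro k u hu
      rw [pow_succ, ← Matrix.mulVec_mulVec]
      have := ih (k - 2) _ (hW.lowers k u hu)
      convert this using 2
      push_cast
      ring
  -- The filtration is recovered from the outside inwards, two steps at a time: `W_l` consists of
  -- the `v ∈ W_{l+1}` with `N^{l+1} v ∈ W_{-l-2}`, and `W_{-l-1} = N^{l+1} W_{l+1} + W_{-l-2}`.
  -- Both descriptions are respected by `X`.
  have key : ∀ n l : ℕ, (∀ k : ℤ, (n : ℤ) ≤ k → W k = ⊤) → (∀ k : ℤ, k < -(n : ℤ) → W k = ⊥) →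
      l ≤ n → (∀ u ∈ W l, X *ᵥ u ∈ W l) ∧ (∀ u ∈ W (-(l : ℤ) - 1), X *ᵥ u ∈ W (-(l : ℤ) - 1)) := by
    intro n l htop hbot hl
    induction hl using Nat.decreasingInduction with
    | self =>
      refine ⟨fun u _ => by rw [htop n le_rfl]; trivial, fun u hu => ?_⟩
      rw [hbot _ (by omega), Submodule.mem_bot] at hu ⊢
      rw [hu, Matrix.mulVec_zero]
    | of_succ l _ ih =>
      obtain ⟨h1, h2⟩ := ih
      have hc : ((l + 1 : ℕ) : ℤ) - 1 = l := by push_cast; ring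
      constructor
      · intro u hu
        rw [← hc]
        refine hW.injective (l + 1) _ (h1 u (hW.monotone (by push_cast; omega) hu)) ?_
        rw [← hpow]
        refine h2 _ (hW.monotone ?_ (hlow (l + 1) l u hu))
        push_cast
        omega
      · intro u hu
        have hc' : -(l : ℤ) - 1 = -((l + 1 : ℕ) : ℤ) := by push_cast; ring
        rw [hc'] at hu ⊢
        obtain ⟨v, hv, huv⟩ := hW.surjective (l + 1) u hu
        have : X *ᵥ u = X *ᵥ (u - (N ^ (l + 1)) *ᵥ v) + (N ^ (l + 1)) *ᵥ (X *ᵥ v) := by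
          rw [Matrix.mulVec_sub, hpow, sub_add_cancel]
        rw [this]
        refine add_mem (hW.monotone (by omega) (h2 _ huv)) ?_
        have := hlow (l + 1) _ _ (h1 v hv)
        convert this using 2
        ring
  obtain ⟨a, ha⟩ := hW.exists_top
  obtain ⟨b, hb⟩ := hW.exists_bot
  set n := max a.natAbs (max b.natAbs k.natAbs) + 1
  have htop : ∀ k : ℤ, (n : ℤ) ≤ k → W k = ⊤ := fun k hk =>
    top_le_iff.mp (ha ▸ hW.monotone (by omega))
  have hbot : ∀ k : ℤ, k < -(n : ℤ) → W k = ⊥ := fun k hk =>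
    le_bot_iff.mp (hb ▸ hW.monotone (by omega))
  rcases le_or_gt 0 k with hk | hk
  · obtain ⟨l, rfl⟩ := Int.eq_ofNat_of_zero_le hk
    exact (key n l htop hbot (by omega)).1 v hv
  · obtain ⟨l, hl⟩ := Int.eq_ofNat_of_zero_le (show 0 ≤ -k - 1 by omega)
    have hkl : k = -(l : ℤ) - 1 := by omega
    rw [hkl] at hv ⊢
    exact (key n l htop hbot (by omega)).2 v hv

section Cone

variable {κ : Type*} [Fintype κ] {N : κ → Matrix ι ι ℝ} {W : ℤ → Submodule ℝ (ι → ℝ)}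

theorem IsConeWeightFiltration.mulVec_mem (hW : IsConeWeightFiltration N W) {X : Matrix ι ι ℝ}
    (hX : ∀ i, Commute X (N i)) (k : ℤ) {v : ι → ℝ} (hv : v ∈ W k) : X *ᵥ v ∈ W k :=
  (hW 1 fun _ => one_pos).mulVec_mem
    (Commute.sum_right _ _ _ fun i _ => (hX i).smul_right _) k hv

/-- A generator lies on the boundary of the open cone, but it is the difference of two interior
points, with parameters `1 + e_i` and `1`. -/
theorem IsConeWeightFiltration.lowers (hW : IsConeWeightFiltration N W) (i : κ) (k : ℤ)
    {v : ι → ℝ} (hv : v ∈ W k) : N i *ᵥ v ∈ W (k - 2) := by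
  classical
  have h1 := (hW 1 fun _ => one_pos).lowers k v hv
  have h2 := (hW (1 + Pi.single i 1) fun j => by
    by_cases h : j = i
    · subst h; simp
    · simp [h]).lowers k v hv
  have : N i = ∑ j, (1 + Pi.single i 1 : κ → ℝ) j • N j - ∑ j, (1 : κ → ℝ) j • N j := by
    simp [add_smul, Finset.sum_add_distrib, Pi.single_apply, ite_smul]
  rw [this, Matrix.sub_mulVec]
  exact sub_mem h2 h1

end Cone

/-- The spectral projections of `Z` cut a matrix into blocks `Q_a X Q_b`, each of `ad Z`-weight `a -
b`. -/
theorem iSup_eigenspace_ad_eq_top {Z : Matrix ι ι ℝ} {q : ℤ → Module.End ℝ (ι → ℝ)}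
    (hq : IsWeightProjections (Matrix.toLin' Z) q) :
    ⨆ n : ℤ, Module.End.eigenspace (LieAlgebra.ad ℝ (Matrix ι ι ℝ) Z) (n : ℝ) = ⊤ := by
  obtain ⟨s, hs⟩ := hq.exists_sum
  set Q : ℤ → Matrix ι ι ℝ := fun n => LinearMap.toMatrix' (q n)
  have hQ : ∀ n v, Q n *ᵥ v = q n v := fun n v => LinearMap.toMatrix'_mulVec _ _
  have hZQ : ∀ n : ℤ, Z * Q n = (n : ℝ) • Q n := fun n => by
    refine Matrix.toLin'.injective (LinearMap.ext fun v => ?_)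
    have := hq.apply_mem n v
    rw [Matrix.toLin'_apply] at this
    simp only [Matrix.toLin'_apply, ← Matrix.mulVec_mulVec, Matrix.smul_mulVec, hQ, this]
  have hQZ : ∀ n : ℤ, Q n * Z = (n : ℝ) • Q n := fun n => by
    refine Matrix.toLin'.injective (LinearMap.ext fun v => ?_)
    have h1 := hq.apply_mem n v
    have h2 := hq.apply_comm (S := Matrix.toLin' Z) (fun _ => rfl) n v
    rw [Matrix.toLin'_apply] at h1 h2
    simp only [Matrix.toLin'_apply, ← Matrix.mulVec_mulVec, Matrix.smul_mulVec, hQ, h2, h1]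
  have hsum : ∑ n ∈ s, Q n = 1 := by
    refine Matrix.toLin'.injective (LinearMap.ext fun v => ?_)
    simp only [Matrix.toLin'_apply, Matrix.sum_mulVec, hQ, Matrix.one_mulVec]
    rw [← LinearMap.sum_apply, hs, Module.End.one_apply]
  refine eq_top_iff.mpr fun X _ => ?_
  have hX : X = ∑ a ∈ s, ∑ b ∈ s, Q a * X * Q b := by
    simp only [← Finset.mul_sum, ← Finset.sum_mul, hsum, mul_one, one_mul]
  rw [hX]
  refine Submodule.sum_mem _ fun a _ => Submodule.sum_mem _ fun b _ =>
    Submodule.mem_iSup_of_mem (a - b) ?_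
  rw [Module.End.mem_eigenspace_iff, LieAlgebra.ad_apply, LieRing.of_associative_ring_bracket,
    mul_assoc _ _ Z, hQZ, ← mul_assoc Z, ← mul_assoc Z, hZQ]
  simp only [smul_mul_assoc, mul_smul_comm, ← sub_smul, Int.cast_sub]

theorem lie_mulVec_eigenvector {Z X : Matrix ι ι ℝ} {a b : ℝ} {v : ι → ℝ} (hX : ⁅Z, X⁆ = b • X)
    (hv : Z *ᵥ v = a • v) : Z *ᵥ (X *ᵥ v) = (a + b) • (X *ᵥ v) := by
  have : Z * X = b • X + X * Z := by rw [← hX, LieRing.of_associative_ring_bracket]; abel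
  rw [Matrix.mulVec_mulVec, this, Matrix.add_mulVec, ← Matrix.mulVec_mulVec, hv,
    Matrix.mulVec_smul, Matrix.smul_mulVec, add_smul, add_comm]

/-- On an eigenvector `v` of weight `a`, the matrix `p l X` gives the part of `X v` of weight `a +
l`, while `X v` has only weights at most `a + d`. -/
theorem IsGrading.proj_eq_zero {Z : Matrix ι ι ℝ} {W : ℤ → Submodule ℝ (ι → ℝ)}
    (hZ : IsGrading Z W) {p : ℤ → Module.End ℝ (Matrix ι ι ℝ)}
    (hp : IsWeightProjections (LieAlgebra.ad ℝ (Matrix ι ι ℝ) Z) p) {X : Matrix ι ι ℝ} {d : ℤ}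
    (hX : ∀ k, ∀ v ∈ W k, X *ᵥ v ∈ W (k + d)) {l : ℤ} (hl : d < l) : p l X = 0 := by
  obtain ⟨q, hq⟩ := exists_isWeightProjections hZ.semisimple
  refine eq_of_mulVec_eq_of_iSup_eq_top hZ.semisimple fun a v hv => ?_
  have hvW : v ∈ W a := by
    rw [hZ.filtration]
    exact Submodule.mem_iSup_of_mem (⟨a, le_rfl⟩ : {l : ℤ // l ≤ a}) hv
  rw [Module.End.mem_eigenspace_iff, Matrix.toLin'_apply] at hv
  have h1 : q (a + l) (X *ᵥ v) = 0 := by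
    have h2 := hX a v hvW
    rw [hZ.filtration] at h2
    have h3 : ⨆ b : {b : ℤ // b ≤ a + d}, Module.End.eigenspace (Matrix.toLin' Z) (b : ℝ) ≤
        LinearMap.ker (q (a + l)) := iSup_le fun b u hu => by
      have hb := b.2
      exact hq.apply_ne _ _ _ (Module.End.mem_eigenspace_iff.mp hu) (by omega)
    exact h3 h2
  have hmem : ∀ n : ℤ, Matrix.toLin' Z (p n X *ᵥ v) = ((a + n : ℤ) : ℝ) • (p n X *ᵥ v) :=
    fun n => by
      rw [Matrix.toLin'_apply, lie_mulVec_eigenvector (hp.apply_mem n X) hv, Int.cast_add]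
  obtain ⟨s, hs⟩ := hp.eq_sum
  rw [Matrix.zero_mulVec]
  have h4 : X *ᵥ v = ∑ n ∈ s, p n X *ᵥ v := by
    conv_lhs => rw [hs X, Matrix.sum_mulVec]
  rw [h4, map_sum] at h1
  by_cases hls : l ∈ s
  · rw [Finset.sum_eq_single_of_mem l hls fun n _ hn => hq.apply_ne _ _ _ (hmem n) (by omega),
      hq.apply_self _ _ (hmem l)] at h1
    exact h1
  · have : p l X = 0 := by
      rw [hs X, map_sum]
      exact Finset.sum_eq_zero fun k hk => hp.apply_apply_ne (ne_of_mem_of_not_mem hk hls).symm X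
    rw [this, Matrix.zero_mulVec]

end WeightFiltrations

/-! ### The triples of Cattani, Kaplan and Schmid -/

section CKSSystem

variable {ι : Type*} [Fintype ι] [DecidableEq ι] {D : HodgeDomain ι} {m : ℕ}
  {N : Fin m → Matrix ι ι ℝ} {I : ℤ × ℤ → Submodule ℂ (ι → ℂ)} {T : Fin m → StandardTriple D.𝔤}

theorem gradingOf_eq (T : Fin m → StandardTriple D.𝔤) (j : ℕ) :
    gradingOf D T j = (D.w : ℝ) • 1 +
      ∑ k : Fin m, if (k : ℕ) < j then ((T k).neut : Matrix ι ι ℝ) else 0 := by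
  rw [gradingOf, ← Finset.sum_filter, Finset.sum_subtype (p := fun k : Fin m => (k : ℕ) < j)]
  simp

theorem gradingOf_succ (T : Fin m → StandardTriple D.𝔤) (j : Fin m) :
    gradingOf D T (j + 1) = gradingOf D T j + ((T j).neut : Matrix ι ι ℝ) := by
  rw [gradingOf_eq, gradingOf_eq, add_assoc]
  congr 1
  have : ((T j).neut : Matrix ι ι ℝ) = ∑ k : Fin m, if k = j then ((T k).neut : Matrix ι ι ℝ) else 0 := by
    simp
  rw [this, ← Finset.sum_add_distrib]
  refine Finset.sum_congr rfl fun k _ => ?_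
  rcases lt_trichotomy k j with h | rfl | h
  · have : (k : ℕ) < j := h
    simp [h.ne, this, this.le]
  · simp
  · have : (j : ℕ) < k := h
    simp [h.ne', this.not_gt, this.not_ge]

theorem coe_lie_neut_pos (t : StandardTriple D.𝔤) :
    ⁅(t.neut : Matrix ι ι ℝ), (t.pos : Matrix ι ι ℝ)⁆ = (2 : ℝ) • (t.pos : Matrix ι ι ℝ) := by
  have := congrArg (Subtype.val) t.lie_neut_pos
  rw [LieSubalgebra.coe_bracket] at this
  rw [this, two_smul, two_smul]
  rfl

theorem coe_lie_pos_neg (t : StandardTriple D.𝔤) :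
    ⁅(t.pos : Matrix ι ι ℝ), (t.neg : Matrix ι ι ℝ)⁆ = (t.neut : Matrix ι ι ℝ) := by
  have := congrArg (Subtype.val) t.lie_pos_neg
  rwa [LieSubalgebra.coe_bracket] at this

theorem coe_lie_neut_neg (t : StandardTriple D.𝔤) :
    ⁅(t.neut : Matrix ι ι ℝ), (t.neg : Matrix ι ι ℝ)⁆ = (-2 : ℝ) • (t.neg : Matrix ι ι ℝ) := by
  have := congrArg (Subtype.val) t.lie_neut_neg
  rw [LieSubalgebra.coe_bracket] at this
  rw [this, neg_smul, neg_smul, two_smul, two_smul]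
  rfl

theorem lie_eq_zero_iff_commute {A B : Matrix ι ι ℝ} : ⁅A, B⁆ = 0 ↔ Commute A B := by
  rw [LieRing.of_associative_ring_bracket, sub_eq_zero]
  rfl

/-! ### Descending from `Y^m` to all gradings by naturality. -/

namespace IsCKSSystem

variable (hT : IsCKSSystem D N I T)
include hT

theorem exists_projections {j : ℕ} (hj : j ≤ m) :
    ∃ p, IsWeightProjections (LieAlgebra.ad ℝ (Matrix ι ι ℝ) (gradingOf D T j)) p := by
  obtain ⟨W, -, hW⟩ := hT.grading j hj
  obtain ⟨q, hq⟩ := exists_isWeightProjections hW.semisimple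
  exact exists_isWeightProjections (iSup_eigenspace_ad_eq_top hq)

theorem proj_zero_eq_neg (j : Fin m) {p : ℤ → Module.End ℝ (Matrix ι ι ℝ)}
    (hp : IsWeightProjections (LieAlgebra.ad ℝ (Matrix ι ι ℝ) (gradingOf D T j)) p) :
    p 0 (N j) = ((T j).neg : Matrix ι ι ℝ) := by
  have h1 : p 0 (N j - ((T j).neg : Matrix ι ι ℝ)) = 0 := by
    have hle : ⨆ c : {c : ℝ // c ≠ 0}, Module.End.eigenspace
        (LieAlgebra.ad ℝ (Matrix ι ι ℝ) (gradingOf D T j)) (c : ℝ) ≤ LinearMap.ker (p 0) :=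
      iSup_le fun c x hx => hp.apply_eq_zero_of_eigenvector (by simpa using c.2)
        (Module.End.mem_eigenspace_iff.mp hx)
    exact hle (hT.sub_neg_mem j)
  have h2 : p 0 ((T j).neg : Matrix ι ι ℝ) = ((T j).neg : Matrix ι ι ℝ) :=
    hp.apply_self 0 _ (by
      rw [LieAlgebra.ad_apply, lie_eq_zero_iff_commute.mpr (hT.commute_neg j)]; simp)
  rw [← h2, ← sub_eq_zero, ← map_sub, h1]

/-- One downward step: naturality with `Y = Y^{j+1}` and `Z = Y^j`. The weight bounds on `N_j` and
`A` come from their action on the filtration of the smaller cone. The hypothesis on `A` ranges over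
all `W` because `IsCKSSystem` only provides some `W`. -/
theorem lie_grading_of_lie_grading_succ (hN : ∀ i k, Commute (N i) (N k)) (j : Fin m)
    {A : Matrix ι ι ℝ} {d : ℤ} (hA : ⁅N j, A⁆ = 0)
    (hYA : ⁅gradingOf D T (j + 1), A⁆ = (d : ℝ) • A)
    (hWA : ∀ W : ℤ → Submodule ℝ (ι → ℝ),
      IsConeWeightFiltration (fun k : {k : Fin m // (k : ℕ) < j} => N k) W →
        ∀ k, ∀ v ∈ W k, A *ᵥ v ∈ W (k + d)) :
    ⁅gradingOf D T j, A⁆ = (d : ℝ) • A := by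
  obtain ⟨p, hp⟩ := hT.exists_projections j.2.le
  obtain ⟨W, hW, hWY⟩ := hT.grading j j.2.le
  have hsub : gradingOf D T (j + 1) - gradingOf D T j = ((T j).neut : Matrix ι ι ℝ) := by
    rw [gradingOf_succ, add_sub_cancel_left]
  refine lie_eq_smul_of_naturality (Y := gradingOf D T (j + 1)) (N := N j) hp
    (lie_eq_zero_iff_commute.mpr (hT.commute j)) (lie_eq_zero_iff_commute.mpr (hT.commute_neg j))
    (hsub ▸ coe_lie_neut_pos (T j)) (hsub ▸ coe_lie_pos_neg (T j)) (hT.proj_zero_eq_neg j hp)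
    (hT.lie_pos j) (fun l hl => ?_) hA hYA (fun k hk => ?_)
  · refine hWY.proj_eq_zero hp (d := 0) (fun k v hv => ?_) hl
    rw [add_zero]
    exact hW.mulVec_mem (fun i => hN j i) _ hv
  · refine hWY.proj_eq_zero hp (d := d) (fun k v hv => ?_) hk
    have := hWA W hW _ v hv
    rwa [show k - D.w + d = k + d - D.w by ring] at this

theorem lie_grading_N (hN : ∀ i k, Commute (N i) (N k))
    (hY : ∀ i, ⁅gradingOf D T m, N i⁆ = (-2 : ℝ) • N i) {j : ℕ} (hj : j ≤ m) (i : Fin m)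
    (hi : (i : ℕ) < j) : ⁅gradingOf D T j, N i⁆ = (-2 : ℝ) • N i := by
  induction hj using Nat.decreasingInduction with
  | self => exact hY i
  | of_succ j hjm ih =>
    have := hT.lie_grading_of_lie_grading_succ hN ⟨j, hjm⟩ (A := N i) (d := -2)
      (lie_eq_zero_iff_commute.mpr (hN _ _)) (by simpa using ih (by omega))
      (fun W hW k v hv => hW.lowers (⟨i, hi⟩ : {k : Fin m // (k : ℕ) < j}) k hv)
    simpa using this

theorem commute_grading (hN : ∀ i k, Commute (N i) (N k)) {A : Matrix ι ι ℝ}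
    (hA : ∀ i, Commute A (N i)) (hY : Commute A (gradingOf D T m)) {j : ℕ} (hj : j ≤ m) :
    Commute A (gradingOf D T j) := by
  induction hj using Nat.decreasingInduction with
  | self => exact hY
  | of_succ j hjm ih =>
    have := hT.lie_grading_of_lie_grading_succ hN ⟨j, hjm⟩ (A := A) (d := 0)
      (lie_eq_zero_iff_commute.mpr (hA _).symm)
      (by simpa using lie_eq_zero_iff_commute.mpr ih.symm)
      (fun W hW k v hv => by rw [add_zero]; exact hW.mulVec_mem (fun i => hA i) k hv)
    rw [Int.cast_zero, zero_smul] at this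
    exact (lie_eq_zero_iff_commute.mp this).symm

/-- The definition gives commutation of neighbours only. For `k > j`, both `Y^k` and `Y^{j+1}` give
weight -2 to the first `j + 1` of the `N_i`, so their difference commutes with these and is a
legitimate `A` for naturality. It follows that `[Y^j, Y^k] = [Y^j, Y^{j+1}] = 0`. -/
theorem commute_grading_grading (hN : ∀ i k, Commute (N i) (N k))
    (hY : ∀ i, ⁅gradingOf D T m, N i⁆ = (-2 : ℝ) • N i) {j k : ℕ} (hj : j ≤ m) (hk : k ≤ m) :
    Commute (gradingOf D T j) (gradingOf D T k) := by
  have key : ∀ {j : ℕ}, j ≤ m → ∀ k, j ≤ k → k ≤ m →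
      ⁅gradingOf D T j, gradingOf D T k⁆ = 0 := by
    intro j hj
    induction hj using Nat.decreasingInduction with
    | self =>
      intro k h1 h2
      rw [le_antisymm h2 h1, lie_self]
    | of_succ j hjm ih =>
      intro k h1 h2
      rcases h1.eq_or_lt with rfl | h1
      · rw [lie_self]
      have hsub : ∀ i : Fin m, (i : ℕ) < j + 1 →
          ⁅N i, gradingOf D T k - gradingOf D T (j + 1)⁆ = 0 := fun i hi => by
        rw [lie_sub, ← lie_skew, ← lie_skew (N i) (gradingOf D T (j + 1)),
          hT.lie_grading_N hN hY h2 i (by omega), hT.lie_grading_N hN hY hjm i hi, sub_self]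
      have := hT.lie_grading_of_lie_grading_succ hN ⟨j, hjm⟩
        (A := gradingOf D T k - gradingOf D T (j + 1)) (d := 0) (hsub _ (Nat.lt_succ_self j))
        (by rw [lie_sub, ih k h1 h2, lie_self]; simp)
        (fun W hW k v hv => by
          rw [add_zero]
          exact hW.mulVec_mem (fun i => (lie_eq_zero_iff_commute.mp
            (hsub i (by have := i.2; simp only at this; omega))).symm) k hv)
      rw [Int.cast_zero, zero_smul, lie_sub, sub_eq_zero] at this
      rw [this]
      exact lie_eq_zero_iff_commute.mpr (hT.commute ⟨j, hjm⟩)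
  rcases le_total j k with h | h
  · exact lie_eq_zero_iff_commute.mp (key hj k h hk)
  · exact (lie_eq_zero_iff_commute.mp (key hk j h hj)).symm

theorem commute_neut (hN : ∀ i k, Commute (N i) (N k)) {A : Matrix ι ι ℝ}
    (hA : ∀ i, Commute A (N i)) (hY : Commute A (gradingOf D T m)) (j : Fin m) :
    Commute A ((T j).neut : Matrix ι ι ℝ) := by
  rw [← add_sub_cancel_left (gradingOf D T j) ((T j).neut : Matrix ι ι ℝ), ← gradingOf_succ]
  exact (hT.commute_grading hN hA hY j.2).sub_right (hT.commute_grading hN hA hY j.2.le)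

/-- `ad A` commutes with `ad Y^j`, hence with the projection that takes `N_j` to `N̂_j`. -/
theorem commute_neg_of_commute (j : Fin m) {A : Matrix ι ι ℝ} (hA : Commute A (N j))
    (hY : Commute A (gradingOf D T j)) : Commute A ((T j).neg : Matrix ι ι ℝ) := by
  obtain ⟨p, hp⟩ := hT.exists_projections j.2.le
  rw [← hT.proj_zero_eq_neg j hp, ← lie_eq_zero_iff_commute]
  have hYA := lie_eq_zero_iff_commute.mpr hY.symm
  have := hp.apply_comm (S := LieAlgebra.ad ℝ (Matrix ι ι ℝ) A) (fun X => by
    simp only [LieAlgebra.ad_apply]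
    rw [leibniz_lie, hYA, zero_lie, zero_add]) 0 (N j)
  simp only [LieAlgebra.ad_apply] at this
  rw [← this, lie_eq_zero_iff_commute.mpr hA, map_zero]

theorem commute_pos (hN : ∀ i k, Commute (N i) (N k)) {A : Matrix ι ι ℝ}
    (hA : ∀ i, Commute A (N i)) (hY : Commute A (gradingOf D T m)) (j : Fin m) :
    Commute A ((T j).pos : Matrix ι ι ℝ) := by
  refine (lie_eq_zero_iff_commute.mp (lie_pos_eq_zero (coe_lie_neut_pos (T j))
    (coe_lie_pos_neg (T j)) ?_ ?_)).symm
  · exact lie_eq_zero_iff_commute.mpr (hT.commute_neut hN hA hY j).symm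
  · exact lie_eq_zero_iff_commute.mpr
      (hT.commute_neg_of_commute j (hA j) (hT.commute_grading hN hA hY j.2.le)).symm

theorem isRealDiagonalizable_grading {j : ℕ} (hj : j ≤ m) :
    IsRealDiagonalizable (gradingOf D T j) := by
  obtain ⟨W, -, hW⟩ := hT.grading j hj
  exact top_le_iff.mp (hW.semisimple.ge.trans (iSup_le fun l =>
    le_iSup (fun μ : ℝ => Module.End.eigenspace (Matrix.toLin' (gradingOf D T j)) μ) (l : ℝ)))

theorem isRealDiagonalizable_neut (j : Fin m) :
    IsRealDiagonalizable ((T j).neut : Matrix ι ι ℝ) := by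
  have h := IsRealDiagonalizable.sum_smul
    (A := ![gradingOf D T j, gradingOf D T (j + 1)])
    (by
      intro i
      fin_cases i
      · exact hT.isRealDiagonalizable_grading j.2.le
      · exact hT.isRealDiagonalizable_grading j.2)
    (by
      intro i k
      fin_cases i <;> fin_cases k
      · exact Commute.refl _
      · exact hT.commute j
      · exact (hT.commute j).symm
      · exact Commute.refl _) ![-1, 1]
  simpa [gradingOf_succ] using h

theorem commute_neut_neut (hN : ∀ i k, Commute (N i) (N k))
    (hY : ∀ i, ⁅gradingOf D T m, N i⁆ = (-2 : ℝ) • N i) (j k : Fin m) :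
    Commute ((T j).neut : Matrix ι ι ℝ) ((T k).neut : Matrix ι ι ℝ) := by
  have h := fun {a b : ℕ} (ha : a ≤ m) (hb : b ≤ m) =>
    hT.commute_grading_grading hN hY ha hb
  rw [← add_sub_cancel_left (gradingOf D T j) ((T j).neut : Matrix ι ι ℝ), ← gradingOf_succ,
    ← add_sub_cancel_left (gradingOf D T k) ((T k).neut : Matrix ι ι ℝ), ← gradingOf_succ]
  exact ((h j.2 k.2).sub_right (h j.2 k.2.le)).sub_left
    ((h j.2.le k.2).sub_right (h j.2.le k.2.le))

/-- `H_j` is the difference of two gradings, both giving `N_i` weight -2, so it commutes with `N_i`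
and with `Y^i`. This triangular half of the commutation relations suffices for independence. -/
theorem lie_neut_neg_of_lt (hN : ∀ i k, Commute (N i) (N k))
    (hY : ∀ i, ⁅gradingOf D T m, N i⁆ = (-2 : ℝ) • N i) {i j : Fin m} (hij : i < j) :
    ⁅((T j).neut : Matrix ι ι ℝ), ((T i).neg : Matrix ι ι ℝ)⁆ = 0 := by
  refine lie_eq_zero_iff_commute.mpr (hT.commute_neg_of_commute i ?_ ?_)
  · rw [← lie_eq_zero_iff_commute, ← add_sub_cancel_left (gradingOf D T j)
      ((T j).neut : Matrix ι ι ℝ), ← gradingOf_succ, sub_lie,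
      hT.lie_grading_N hN hY j.2.le i hij, hT.lie_grading_N hN hY j.2 i (by omega), sub_self]
  · rw [← add_sub_cancel_left (gradingOf D T j) ((T j).neut : Matrix ι ι ℝ), ← gradingOf_succ]
    exact (hT.commute_grading_grading hN hY j.2 i.2.le).sub_left
      (hT.commute_grading_grading hN hY j.2.le i.2.le)

omit hT in
theorem _root_.NilpotentCone.StandardTriple.IsNontrivial.neut_ne_zero {t : StandardTriple D.𝔤}
    (ht : t.IsNontrivial) : (t.neut : Matrix ι ι ℝ) ≠ 0 := by
  intro h0
  have h1 := coe_lie_neut_pos t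
  have h2 := coe_lie_neut_neg t
  rw [h0, zero_lie] at h1 h2
  have h1' := (smul_eq_zero.mp h1.symm).resolve_left two_ne_zero
  have h2' := (smul_eq_zero.mp h2.symm).resolve_left (by norm_num)
  rcases ht with h | h | h
  · exact h (Subtype.ext h1')
  · exact h (Subtype.ext h0)
  · exact h (Subtype.ext h2')

theorem linearIndependent_neut (hN : ∀ i k, Commute (N i) (N k))
    (hY : ∀ i, ⁅gradingOf D T m, N i⁆ = (-2 : ℝ) • N i) :
    LinearIndependent ℝ
      fun j : {j : Fin m // (T j).IsNontrivial} => ((T j).neut : Matrix ι ι ℝ) := by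
  classical
  rw [Fintype.linearIndependent_iff]
  intro c hc
  -- Bracketing the relation with `N̂_i` removes the terms below `i` by induction and those above by
  -- commutation, leaving `-2 c_i N̂_i = 0`. If `N̂_i = 0`, then `H_i = [N̂_i⁺, N̂_i]` vanishes too.
  have key : ∀ (n : ℕ) (i : {j : Fin m // (T j).IsNontrivial}), ((i : Fin m) : ℕ) = n →
      c i • ((T i).neut : Matrix ι ι ℝ) = 0 := by
    intro n
    induction n using Nat.strong_induction_on with
    | _ n ih =>
      intro i hi
      have h1 : ∑ j, ⁅c j • ((T j).neut : Matrix ι ι ℝ), ((T i).neg : Matrix ι ι ℝ)⁆ = 0 := by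
        rw [← sum_lie, hc, zero_lie]
      rw [Finset.sum_eq_single_of_mem i (Finset.mem_univ i), smul_lie, coe_lie_neut_neg,
        smul_smul, smul_eq_zero] at h1
      · rcases h1 with h | h
        · have : c i = 0 := by linarith
          rw [this, zero_smul]
        · rw [← coe_lie_pos_neg, h, lie_zero, smul_zero]
      · intro j _ hji
        rcases lt_or_gt_of_ne (fun h => hji (Subtype.ext h) : (j : Fin m) ≠ i) with h | h
        · rw [ih j (by rw [← hi]; exact h) j rfl, zero_lie]
        · rw [smul_lie, hT.lie_neut_neg_of_lt hN hY h, smul_zero]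
  exact fun i => (smul_eq_zero.mp (key _ i rfl)).resolve_right i.2.neut_ne_zero

end IsCKSSystem

end CKSSystem

/-! ### Complexification -/

section Complexification

variable {ι : Type*}

theorem cplx_add (A B : Matrix ι ι ℝ) : cplx (A + B) = cplx A + cplx B := by
  ext i j; simp [cplx]

theorem cplx_sub (A B : Matrix ι ι ℝ) : cplx (A - B) = cplx A - cplx B := by
  ext i j; simp [cplx]

theorem cplx_smul (c : ℝ) (A : Matrix ι ι ℝ) : cplx (c • A) = (c : ℂ) • cplx A := by
  ext i j; simp [cplx]

theorem cplx_injective : Function.Injective (cplx : Matrix ι ι ℝ → Matrix ι ι ℂ) :=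
  Matrix.map_injective Complex.ofReal_injective

variable [Fintype ι]

theorem cplx_mul (A B : Matrix ι ι ℝ) : cplx (A * B) = cplx A * cplx B :=
  Matrix.map_mul (f := Complex.ofRealHom)

omit [Fintype ι] in
theorem cplx_sum {κ : Type*} (s : Finset κ) (A : κ → Matrix ι ι ℝ) :
    cplx (∑ k ∈ s, A k) = ∑ k ∈ s, cplx (A k) := by
  ext i j; simp [cplx, Matrix.sum_apply]

theorem cplx_mulVec_ofReal (A : Matrix ι ι ℝ) (v : ι → ℝ) :
    cplx A *ᵥ (fun i => (v i : ℂ)) = fun i => ((A *ᵥ v) i : ℂ) := by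
  ext i; simp [cplx, Matrix.mulVec, dotProduct]

theorem star_cplx_mulVec (A : Matrix ι ι ℝ) (v : ι → ℂ) :
    star (cplx A *ᵥ v) = cplx A *ᵥ star v := by
  ext i; simp [cplx, Matrix.mulVec, dotProduct]

theorem commute_of_commute_cplx {A B : Matrix ι ι ℝ} (h : Commute (cplx A) (cplx B)) :
    Commute A B :=
  cplx_injective (by rw [cplx_mul, cplx_mul, h.eq])

theorem commute_cplx {A B : Matrix ι ι ℝ} (h : Commute A B) : Commute (cplx A) (cplx B) := by
  rw [commute_iff_eq, ← cplx_mul, ← cplx_mul, h.eq]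

theorem cplx_mulVec_mem_cplxSubspace {A : Matrix ι ι ℝ} {U U' : Submodule ℝ (ι → ℝ)}
    (h : ∀ v ∈ U, A *ᵥ v ∈ U') {v : ι → ℂ} (hv : v ∈ cplxSubspace U) :
    cplx A *ᵥ v ∈ cplxSubspace U' := by
  have hle : cplxSubspace U ≤ (cplxSubspace U').comap (cplx A).mulVecLin := by
    refine Submodule.span_le.mpr ?_
    rintro _ ⟨u, hu, rfl⟩
    refine Submodule.subset_span ⟨A *ᵥ u, h u hu, ?_⟩
    exact (cplx_mulVec_ofReal A u).symm
  exact hle hv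

omit [Fintype ι] in
theorem mem_conjSubspace {U : Submodule ℂ (ι → ℂ)} {v : ι → ℂ} :
    v ∈ conjSubspace U ↔ star v ∈ U := Iff.rfl

end Complexification

/-! ### Projections of a direct sum decomposition -/

section Bigrading

theorem exists_directSum_projections {K V α : Type*} [Field K] [AddCommGroup V] [Module K V]
    [DecidableEq α] {I : α → Submodule K V} (hI : DirectSum.IsInternal I) :
    ∃ π : α → Module.End K V, (∀ a, ∀ v ∈ I a, π a v = v) ∧
      (∀ a b, a ≠ b → ∀ v ∈ I b, π a v = 0) ∧ (∀ a v, π a v ∈ I a) ∧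
      ∀ a v, (∀ b, b ≠ a → π b v = 0) → v ∈ I a := by
  classical
  let : DirectSum.Decomposition I := hI.chooseDecomposition
  let π : α → Module.End K V := fun a => (I a).subtype ∘ₗ
    DirectSum.component K α (fun a => I a) a ∘ₗ (DirectSum.decomposeLinearEquiv I).toLinearMap
  have hπ : ∀ a v, π a v = (DirectSum.decompose I v a : V) := fun a v => rfl
  refine ⟨π, fun a v hv => ?_, fun a b hab v hv => ?_, fun a v => SetLike.coe_mem _,
    fun a v h => ?_⟩
  · rw [hπ]; exact DirectSum.decompose_of_mem_same _ hv
  · rw [hπ]; exact DirectSum.decompose_of_mem_ne _ hv hab.symm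
  · rw [← DirectSum.sum_support_decompose I v]
    refine Submodule.sum_mem _ fun b _ => ?_
    by_cases hb : b = a
    · subst hb; exact SetLike.coe_mem _
    · rw [← hπ, h b hb]; exact zero_mem _

theorem exists_linearMap_smul_of_isInternal {K V α : Type*} [Field K] [AddCommGroup V] [Module K V]
    [DecidableEq α] {I : α → Submodule K V} (hI : DirectSum.IsInternal I) (c : α → K) :
    ∃ f : Module.End K V, ∀ a, ∀ v ∈ I a, f v = c a • v := by
  let : DirectSum.Decomposition I := hI.chooseDecomposition
  refine ⟨DirectSum.toModule K α V (fun a => c a • (I a).subtype) ∘ₗ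
    (DirectSum.decomposeLinearEquiv I).toLinearMap, fun a v hv => ?_⟩
  have : DirectSum.decomposeLinearEquiv I v = DirectSum.lof K α (fun a => I a) a ⟨v, hv⟩ :=
    DirectSum.decompose_of_mem I hv
  rw [LinearMap.comp_apply, LinearEquiv.coe_coe, this, DirectSum.toModule_lof]
  rfl

variable {ι : Type*} [Fintype ι] [DecidableEq ι]

omit [DecidableEq ι] in
theorem smul_eq_of_proj_ne_zero {α : Type*} [DecidableEq α] {I : α → Submodule ℂ (ι → ℂ)}
    (hI : DirectSum.IsInternal I) {π : α → Module.End ℂ (ι → ℂ)}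
    (hself : ∀ a, ∀ v ∈ I a, π a v = v) (hne : ∀ a b, a ≠ b → ∀ v ∈ I b, π a v = 0)
    (hmem : ∀ a v, π a v ∈ I a) {A : Matrix ι ι ℂ} {c : α → ℂ}
    (hA : ∀ a, ∀ v ∈ I a, A *ᵥ v = c a • v) {v : ι → ℂ} {y : ℂ} (hv : A *ᵥ v = y • v) {a : α}
    (ha : π a v ≠ 0) : c a = y := by
  have hcomm : π a ∘ₗ A.mulVecLin = A.mulVecLin ∘ₗ π a := by
    have hle : ⨆ b, I b ≤ LinearMap.eqLocus (π a ∘ₗ A.mulVecLin) (A.mulVecLin ∘ₗ π a) := by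
      refine iSup_le fun b u hu => ?_
      simp only [LinearMap.mem_eqLocus, LinearMap.comp_apply, Matrix.mulVecLin_apply]
      rw [hA b u hu, map_smul]
      by_cases hab : a = b
      · subst hab; rw [hself a u hu, hA a u hu]
      · rw [hne a b hab u hu, smul_zero, Matrix.mulVec_zero]
    rw [hI.submodule_iSup_eq_top] at hle
    exact LinearMap.ext fun u => hle (Submodule.mem_top (x := u))
  have h1 := LinearMap.congr_fun hcomm v
  simp only [LinearMap.comp_apply, Matrix.mulVecLin_apply] at h1
  rw [hv, map_smul, hA a _ (hmem a v), ← sub_eq_zero, ← sub_smul] at h1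
  exact (sub_eq_zero.mp ((smul_eq_zero.mp h1).resolve_right ha)).symm

namespace IsRSplitBigrading

variable {F : ℤ → Submodule ℂ (ι → ℂ)} {W : ℤ → Submodule ℝ (ι → ℝ)}
  {I : ℤ × ℤ → Submodule ℂ (ι → ℂ)}

omit [Fintype ι] [DecidableEq ι] in
theorem star_mem (hI : IsRSplitBigrading F W I) {p q : ℤ} {v : ι → ℂ} (hv : v ∈ I (p, q)) :
    star v ∈ I (q, p) := by
  rw [← hI.conj q p] at hv
  exact hv

omit [Fintype ι] [DecidableEq ι] in
theorem le_hodge (hI : IsRSplitBigrading F W I) (p q : ℤ) : I (p, q) ≤ F p := by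
  rw [hI.hodge]
  exact le_iSup (fun a : {a : ℤ × ℤ // p ≤ a.1} => I a) ⟨(p, q), le_rfl⟩

omit [Fintype ι] [DecidableEq ι] in
theorem le_weight (hI : IsRSplitBigrading F W I) (p q : ℤ) :
    I (p, q) ≤ cplxSubspace (W (p + q)) := by
  rw [hI.weight]
  exact le_iSup (fun a : {a : ℤ × ℤ // a.1 + a.2 ≤ p + q} => I a) ⟨(p, q), le_rfl⟩

omit [Fintype ι] [DecidableEq ι] in
/-- `V^{p,q} = F^p ∩ conj F^q ∩ W_{p+q}`. -/
theorem mem_of_mem (hI : IsRSplitBigrading F W I) {p q : ℤ} {v : ι → ℂ} (h1 : v ∈ F p)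
    (h2 : star v ∈ F q) (h3 : v ∈ cplxSubspace (W (p + q))) : v ∈ I (p, q) := by
  obtain ⟨π, -, hne, -, hmem⟩ := exists_directSum_projections hI.isInternal
  refine hmem _ _ fun b hb => ?_
  by_contra hbv
  have e1 : p ≤ b.1 := by
    by_contra h
    have hle : F p ≤ LinearMap.ker (π b) := by
      rw [hI.hodge]
      refine iSup_le fun a u hu => hne b a (fun hba => h ?_) u hu
      rw [hba]; exact a.2
    exact hbv (hle h1)
  have e2 : q ≤ b.2 := by
    by_contra h
    have hle : F q ≤ conjSubspace (LinearMap.ker (π b)) := by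
      rw [hI.hodge]
      refine iSup_le fun a u hu => ?_
      obtain ⟨⟨a₁, a₂⟩, ha⟩ := a
      refine hne b (a₂, a₁) (fun hba => h ?_) _ (hI.star_mem hu)
      rw [hba]; exact ha
    have := hle h2
    rw [mem_conjSubspace, star_star] at this
    exact hbv this
  have e3 : b.1 + b.2 ≤ p + q := by
    by_contra h
    have hle : cplxSubspace (W (p + q)) ≤ LinearMap.ker (π b) := by
      rw [hI.weight]
      refine iSup_le fun a u hu => hne b a (fun hba => h ?_) u hu
      rw [hba]; exact a.2
    exact hbv (hle h3)
  exact hb (Prod.ext (by simp only; omega) (by simp only; omega))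

theorem ext_matrix (hI : IsRSplitBigrading F W I) {A B : Matrix ι ι ℂ}
    (h : ∀ p q, ∀ v ∈ I (p, q), A *ᵥ v = B *ᵥ v) : A = B :=
  eq_of_mulVec_eq_of_iSup_eq_top hI.isInternal.submodule_iSup_eq_top fun a v hv => h a.1 a.2 v hv

/-- The real matrix that acts on `V^{p,q}` as `i (p - q)`. -/
theorem exists_circle_generator (hI : IsRSplitBigrading F W I) :
    ∃ P : Matrix ι ι ℝ, ∀ p q : ℤ, ∀ v ∈ I (p, q),
      cplx P *ᵥ v = (Complex.I * ((p : ℂ) - q)) • v := by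
  obtain ⟨f, hf⟩ := exists_linearMap_smul_of_isInternal hI.isInternal
    (fun a => Complex.I * ((a.1 : ℂ) - a.2))
  set P := LinearMap.toMatrix' f
  have hP : ∀ v, P *ᵥ v = f v := fun v => LinearMap.toMatrix'_mulVec _ _
  have hstar : ∀ v, P.map star *ᵥ v = star (P *ᵥ star v) := fun v => by
    ext i; simp [Matrix.mulVec, dotProduct]
  -- Conjugation exchanges `(p, q)` with `(q, p)` and negates `i`; the two signs cancel.
  have hreal : P.map star = P := hI.ext_matrix fun p q v hv => by
    rw [hstar, hP, hP, hf _ _ hv, hf _ _ (hI.star_mem hv), star_smul, star_star]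
    congr 1
    simp
    ring
  refine ⟨P.map Complex.re, fun p q v hv => ?_⟩
  have : cplx (P.map Complex.re) = P := by
    ext i j
    have := congrFun (congrFun hreal i) j
    exact Complex.conj_eq_iff_re.mp this
  rw [this, hP, hf _ _ hv]

end IsRSplitBigrading

/-- A subspace invariant under a diagonalizable operator is the sum of its intersections with the
eigenspaces. It keeps the `ad Y^m`-components of elements of `𝔤` inside `𝔤`. -/
theorem proj_mem_of_invariant {V : Type*} [AddCommGroup V] [Module ℝ V] [FiniteDimensional ℝ V]
    {T : Module.End ℝ V} {p : ℤ → Module.End ℝ V} (hp : IsWeightProjections T p)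
    {U : Submodule ℝ V} (hU : ∀ x ∈ U, T x ∈ U) (n : ℤ) {x : V} (hx : x ∈ U) : p n x ∈ U := by
  have htop : ⨆ μ : ℝ, T.genEigenspace μ 1 = ⊤ := by
    refine eq_top_iff.mpr fun v _ => ?_
    obtain ⟨s, hs⟩ := hp.eq_sum
    rw [hs v]
    exact Submodule.sum_mem _ fun k _ => Submodule.mem_iSup_of_mem (k : ℝ)
      (Module.End.mem_eigenspace_iff.mpr (hp.apply_mem k v))
  have h := Submodule.eq_iSup_inf_genEigenspace 1 hU htop
  have hle : U ≤ U.comap (p n) := by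
    conv_lhs => rw [h]
    refine iSup_le fun μ y hy => ?_
    have hyT : T y = μ • y := Module.End.mem_eigenspace_iff.mp hy.2
    rw [Submodule.mem_comap]
    by_cases hμ : μ = n
    · rw [hp.apply_self n y (hμ ▸ hyT)]; exact hy.1
    · rw [hp.apply_eq_zero_of_eigenvector hμ hyT]; exact zero_mem _
  exact hle hx

end Bigrading

/-! ### The Levi algebra as a centralizer -/

section Levi

variable {ι : Type*} [Fintype ι] [DecidableEq ι] {D : HodgeDomain ι} {m : ℕ}
  {F : ℤ → Submodule ℂ (ι → ℂ)} {N : Fin m → Matrix ι ι ℝ} {W W' : ℤ → Submodule ℝ (ι → ℝ)}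
  {I : ℤ × ℤ → Submodule ℂ (ι → ℂ)} {T : Fin m → StandardTriple D.𝔤}

/-- `N_i` lowers `F` by one, its conjugate by one since `N_i` is real, and the weight by two; these
three filtrations determine the bigrading. -/
theorem IsNilpotentOrbit.mulVec_mem (hN : IsNilpotentOrbit D F N)
    (hW : IsConeWeightFiltration N W) (hI : IsRSplitBigrading F (shift D.w W) I) (i : Fin m)
    {p q : ℤ} {v : ι → ℂ} (hv : v ∈ I (p, q)) : cplx (N i) *ᵥ v ∈ I (p - 1, q - 1) := by
  refine hI.mem_of_mem (hN.horizontal i p v (hI.le_hodge p q hv)) ?_ ?_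
  · rw [star_cplx_mulVec]
    exact hN.horizontal i q _ (hI.le_hodge q p (hI.star_mem hv))
  · refine cplx_mulVec_mem_cplxSubspace (fun u hu => ?_) (hI.le_weight p q hv)
    have := hW.lowers i _ hu
    simp only [shift]
    convert this using 2
    ring

theorem IsCKSSystem.lie_grading_top_N (hN : IsNilpotentOrbit D F N)
    (hW : IsConeWeightFiltration N W) (hI : IsRSplitBigrading F (shift D.w W) I)
    (hT : IsCKSSystem D N I T) (i : Fin m) :
    ⁅gradingOf D T m, N i⁆ = (-2 : ℝ) • N i := by
  refine cplx_injective (hI.ext_matrix fun p q v hv => ?_)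
  rw [LieRing.of_associative_ring_bracket, cplx_sub, cplx_mul, cplx_mul, cplx_smul,
    Matrix.sub_mulVec, ← Matrix.mulVec_mulVec, ← Matrix.mulVec_mulVec, hT.top p q v hv,
    hT.top _ _ _ (hN.mulVec_mem hW hI i hv), Matrix.mulVec_smul, Matrix.smul_mulVec, ← sub_smul]
  congr 1
  push_cast
  ring

variable {P : Matrix ι ι ℝ}
  (hP : ∀ p q : ℤ, ∀ v ∈ I (p, q), cplx P *ᵥ v = (Complex.I * ((p : ℂ) - q)) • v)
include hP

theorem commute_circle_generator_N (hN : IsNilpotentOrbit D F N)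
    (hW : IsConeWeightFiltration N W) (hI : IsRSplitBigrading F (shift D.w W) I) (i : Fin m) :
    Commute P (N i) := by
  refine commute_of_commute_cplx (hI.ext_matrix fun p q v hv => ?_)
  rw [← Matrix.mulVec_mulVec, ← Matrix.mulVec_mulVec, hP p q v hv,
    hP _ _ _ (hN.mulVec_mem hW hI i hv), Matrix.mulVec_smul]
  congr 2
  push_cast
  ring

theorem commute_circle_generator_grading (hI : IsRSplitBigrading F W' I)
    (hT : IsCKSSystem D N I T) : Commute P (gradingOf D T m) := by
  refine commute_of_commute_cplx (hI.ext_matrix fun p q v hv => ?_)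
  rw [← Matrix.mulVec_mulVec, ← Matrix.mulVec_mulVec, hP p q v hv, hT.top p q v hv,
    Matrix.mulVec_smul, Matrix.mulVec_smul, hP p q v hv, hT.top p q v hv, smul_comm]

theorem commute_of_mem_𝔪 (hI : IsRSplitBigrading F W' I) {X : Matrix ι ι ℝ} (hX : X ∈ D.𝔪 I) :
    Commute X P := by
  refine commute_of_commute_cplx ?_
  refine Submodule.iSup_induction (fun p : ℤ => D.component I p p)
    (motive := fun X => Commute X (cplx P)) hX.2 ?_ (Commute.zero_left _)
    (fun _ _ h₁ h₂ => h₁.add_left h₂)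
  rintro k X ⟨-, hX⟩
  refine hI.ext_matrix fun p q v hv => ?_
  rw [← Matrix.mulVec_mulVec, ← Matrix.mulVec_mulVec, hP p q v hv, hP _ _ _ (hX p q v hv),
    Matrix.mulVec_smul]
  congr 2
  push_cast
  ring

/-- `Y^m` differs from an element of `𝔤` by a scalar, so the `ad Y^m`-components of `X` stay in `𝔤`,
and they still commute with `P`. The component of weight `n` preserves `p - q` and shifts `p + q` by
`n`, so it is of type `(n/2, n/2)`. -/
theorem mem_𝔪_of_commute (hI : IsRSplitBigrading F W' I) (hT : IsCKSSystem D N I T)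
    {X : Matrix ι ι ℝ} (hX : X ∈ D.𝔤) (hXP : Commute X P) : X ∈ D.𝔪 I := by
  refine ⟨hX, ?_⟩
  obtain ⟨p, hp⟩ := hT.exists_projections le_rfl
  obtain ⟨π, hself, hne, hmem, hall⟩ := exists_directSum_projections hI.isInternal
  have hY𝔤 : ∀ A ∈ D.𝔤.toSubmodule,
      LieAlgebra.ad ℝ (Matrix ι ι ℝ) (gradingOf D T m) A ∈ D.𝔤.toSubmodule := fun A hA => by
    rw [LieAlgebra.ad_apply, gradingOf, add_lie, sum_lie, smul_lie]
    refine add_mem ?_ (Submodule.sum_mem _ fun k _ => D.𝔤.lie_mem (T k).neut.2 hA)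
    rw [lie_eq_zero_iff_commute.mpr (Commute.one_left A), smul_zero]
    exact zero_mem _
  have hPY := commute_circle_generator_grading hP hI hT
  have hcomm : ∀ n, Commute (p n X) P := fun n => by
    have h1 := hp.apply_comm (S := LieAlgebra.ad ℝ (Matrix ι ι ℝ) P) (fun A => by
      simp only [LieAlgebra.ad_apply]
      rw [leibniz_lie, lie_eq_zero_iff_commute.mpr hPY.symm, zero_lie, zero_add]) n X
    simp only [LieAlgebra.ad_apply] at h1
    rw [lie_eq_zero_iff_commute.mpr hXP.symm, map_zero] at h1
    exact (lie_eq_zero_iff_commute.mp h1.symm).symm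
  obtain ⟨s, hs⟩ := hp.eq_sum
  rw [hs X, cplx_sum]
  refine Submodule.sum_mem _ fun n _ => ?_
  have hn𝔤 : p n X ∈ D.𝔤 := proj_mem_of_invariant hp hY𝔤 n hX
  -- For odd `n` no bidegree has the required sum and difference, so the component is zero and the
  -- rounded quotient is harmless.
  refine Submodule.mem_iSup_of_mem (n / 2) ⟨Submodule.subset_span ⟨_, hn𝔤, rfl⟩, ?_⟩
  intro a b v hv
  have hPu : cplx P *ᵥ (cplx (p n X) *ᵥ v) = (Complex.I * ((a : ℂ) - b)) • (cplx (p n X) *ᵥ v) := by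
    rw [Matrix.mulVec_mulVec, ← (commute_cplx (hcomm n)).eq, ← Matrix.mulVec_mulVec, hP a b v hv,
      Matrix.mulVec_smul]
  have hYu : cplx (gradingOf D T m) *ᵥ (cplx (p n X) *ᵥ v) =
      ((a + b + n : ℤ) : ℂ) • (cplx (p n X) *ᵥ v) := by
    have h1 : gradingOf D T m * p n X = (n : ℝ) • p n X + p n X * gradingOf D T m := by
      have h2 : gradingOf D T m * p n X - p n X * gradingOf D T m = (n : ℝ) • p n X :=
        hp.apply_mem n X
      rw [← h2, sub_add_cancel]
    rw [Matrix.mulVec_mulVec, ← cplx_mul, h1, cplx_add, cplx_mul, cplx_smul, Matrix.add_mulVec,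
      ← Matrix.mulVec_mulVec, hT.top a b v hv, Matrix.mulVec_smul, Matrix.smul_mulVec, ← add_smul]
    congr 1
    push_cast
    ring
  refine hall _ _ fun c hc => ?_
  by_contra hcu
  have e1 := smul_eq_of_proj_ne_zero hI.isInternal hself hne hmem
    (c := fun a => Complex.I * ((a.1 : ℂ) - a.2)) (fun a => hP a.1 a.2) hPu hcu
  have e2 := smul_eq_of_proj_ne_zero hI.isInternal hself hne hmem
    (c := fun a => ((a.1 + a.2 : ℤ) : ℂ)) (fun a => hT.top a.1 a.2) hYu hcu
  have e1' : c.1 - c.2 = a - b := by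
    have := mul_left_cancel₀ Complex.I_ne_zero e1
    exact_mod_cast this
  have e2' : c.1 + c.2 = a + b + n := by exact_mod_cast e2
  exact hc (Prod.ext (by simp only; omega) (by simp only; omega))

end Levi

/-! ### The positive definite form of a polarized Hodge structure -/

section Polarization

variable {ι : Type*} [Fintype ι] [DecidableEq ι]

-- Oppositeness gives `F^p = F^{p+1} + H^{p,w-p}`; the sum is built up downwards from the step where
-- `F` is zero.
omit [Fintype ι] [DecidableEq ι] in
theorem iSup_hodgeComponent_eq_top {w : ℤ} {F : ℤ → Submodule ℂ (ι → ℂ)} (hF : Antitone F)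
    (htop : ∃ p, F p = ⊤) (hbot : ∃ p, F p = ⊥)
    (hopp : ∀ p, IsCompl (F p) (conjSubspace (F (w + 1 - p)))) :
    ⨆ p, hodgeComponent w F p = ⊤ := by
  obtain ⟨a, ha⟩ := htop
  obtain ⟨b, hb⟩ := hbot
  have key : ∀ n : ℕ, F (b - n) ≤ ⨆ p, hodgeComponent w F p := by
    intro n
    induction n with
    | zero => simp [hb]
    | succ n ih =>
      intro v hv
      have hvtop : v ∈ F (b - n) ⊔ conjSubspace (F (w + 1 - (b - n))) := by
        rw [(hopp (b - n)).sup_eq_top]; trivial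
      obtain ⟨x, hx, y, hy, rfl⟩ := Submodule.mem_sup.mp hvtop
      refine add_mem (ih hx) (Submodule.mem_iSup_of_mem (b - (n + 1 : ℕ)) ⟨?_, ?_⟩)
      · have hx' : x ∈ F (b - (n + 1 : ℕ)) := hF (by push_cast; omega) hx
        simpa using sub_mem hv hx'
      · have e : w + 1 - (b - n) = w - (b - (n + 1 : ℕ)) := by push_cast; ring
        rw [e] at hy
        exact hy
  exact top_le_iff.mp ((ha ▸ hF (by omega) : ⊤ ≤ F (b - (b - a).toNat)).trans (key _))

omit [DecidableEq ι] in
theorem formC_star (Q : Matrix ι ι ℝ) (u v : ι → ℂ) :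
    formC Q (star u) (star v) = star (formC Q u v) := by
  rw [formC, formC, ← star_cplx_mulVec, Matrix.star_dotProduct_star, dotProduct_comm]

omit [DecidableEq ι] in
theorem formC_eq_zero_of_ne {w : ℤ} {Q : Matrix ι ι ℝ} {F : ℤ → Submodule ℂ (ι → ℂ)}
    (hF : IsPolarizedHodge w Q F) {p r : ℤ} (hpr : p ≠ r) {u v : ι → ℂ}
    (hu : u ∈ hodgeComponent w F p) (hv : v ∈ hodgeComponent w F r) :
    formC Q u (star v) = 0 := by
  rcases lt_or_gt_of_ne hpr with h | h
  · have h1 := hF.isotropic (w - p) (star u) hu.2 v (hF.antitone (by omega) hv.1)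
    have h2 := formC_star Q (star u) v
    rwa [star_star, h1, star_zero] at h2
  · exact hF.isotropic p u hu.1 (star v) (hF.antitone (by omega) hv.2)

-- The Hodge components of a real vector are orthogonal for `Q(·, conj ·)`, so `Q(Cv, v)` is the sum
-- of the positive terms supplied by the polarization.
omit [DecidableEq ι] in
theorem weilForm_pos {w : ℤ} {Q : Matrix ι ι ℝ} {F : ℤ → Submodule ℂ (ι → ℂ)}
    (hF : IsPolarizedHodge w Q F) {C : Matrix ι ι ℝ}
    (hC : ∀ p, ∀ v ∈ hodgeComponent w F p, cplx C *ᵥ v = (Complex.I ^ (p - (w - p))) • v)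
    {v : ι → ℝ} (hv : v ≠ 0) : 0 < v ⬝ᵥ ((Cᵀ * Q) *ᵥ v) := by
  set u : ι → ℂ := fun i => (v i : ℂ)
  have hu : star u = u := by ext i; simp [u]
  have hu0 : u ≠ 0 := fun h => hv (funext fun i => by simpa [u] using congrFun h i)
  have hform : formC Q (cplx C *ᵥ u) (star u) = ((v ⬝ᵥ ((Cᵀ * Q) *ᵥ v) : ℝ) : ℂ) := by
    have h1 : v ⬝ᵥ ((Cᵀ * Q) *ᵥ v) = (C *ᵥ v) ⬝ᵥ (Q *ᵥ v) := by
      rw [← Matrix.mulVec_mulVec, Matrix.dotProduct_mulVec v, Matrix.vecMul_transpose]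
    rw [hu, h1, formC, cplx_mulVec_ofReal, cplx_mulVec_ofReal]
    simp [dotProduct]
  have hmem : u ∈ ⨆ p, hodgeComponent w F p := by
    rw [iSup_hodgeComponent_eq_top hF.antitone hF.exists_top hF.exists_bot hF.opposed]; trivial
  obtain ⟨f, hf, hfu⟩ := (Submodule.mem_iSup_iff_exists_finsupp _ _).mp hmem
  have hsum : formC Q (cplx C *ᵥ u) (star u) =
      ∑ p ∈ f.support, Complex.I ^ (p - (w - p)) * formC Q (f p) (star (f p)) := by
    have hu' : u = ∑ p ∈ f.support, f p := hfu.symm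
    have e1 : cplx C *ᵥ u = ∑ p ∈ f.support, Complex.I ^ (p - (w - p)) • f p := by
      rw [hu', Matrix.mulVec_sum]
      exact Finset.sum_congr rfl fun p _ => hC p _ (hf p)
    have e2 : star u = ∑ p ∈ f.support, star (f p) := by rw [hu', star_sum]
    rw [e1, e2, formC, Matrix.mulVec_sum, sum_dotProduct]
    refine Finset.sum_congr rfl fun p hp => ?_
    rw [dotProduct_sum, Finset.sum_eq_single_of_mem p hp]
    · rw [smul_dotProduct, smul_eq_mul, formC]
    · intro r _ hr
      rw [smul_dotProduct]
      have := formC_eq_zero_of_ne hF hr.symm (hf p) (hf r)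
      rw [formC] at this
      rw [this, smul_zero]
  have hre : v ⬝ᵥ ((Cᵀ * Q) *ᵥ v) =
      ∑ p ∈ f.support, (Complex.I ^ (p - (w - p)) * formC Q (f p) (star (f p))).re := by
    rw [← Complex.re_sum, ← hsum, hform, Complex.ofReal_re]
  rw [hre]
  refine Finset.sum_pos (fun p hp => hF.positive p _ (hf p) (Finsupp.mem_support_iff.mp hp)) ?_
  rw [Finset.nonempty_iff_ne_empty]
  intro h
  rw [Finsupp.support_eq_empty] at h
  rw [h] at hfu
  exact hu0 hfu.symm

/-- `(i^{p-q})² = (-1)^{p-q} = (-1)^w` on every component. This sign offsets the parity of `Q`,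
which makes `Q(C·, ·)` symmetric. -/
theorem weil_mul_self {w : ℤ} {F : ℤ → Submodule ℂ (ι → ℂ)} {C : Matrix ι ι ℝ}
    (htop : ⨆ p, hodgeComponent w F p = ⊤)
    (hC : ∀ p, ∀ v ∈ hodgeComponent w F p, cplx C *ᵥ v = (Complex.I ^ (p - (w - p))) • v) :
    C * C = ((-1 : ℝ) ^ w) • (1 : Matrix ι ι ℝ) := by
  refine cplx_injective (eq_of_mulVec_eq_of_iSup_eq_top htop fun p v hv => ?_)
  have h1 : cplx (1 : Matrix ι ι ℝ) = 1 := Matrix.map_one _ Complex.ofReal_zero Complex.ofReal_one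
  rw [cplx_mul, cplx_smul, h1, ← Matrix.mulVec_mulVec, hC p v hv, Matrix.mulVec_smul, hC p v hv,
    smul_smul, Matrix.smul_mulVec, Matrix.one_mulVec]
  congr 1
  rw [← mul_zpow, Complex.I_mul_I, Complex.ofReal_zpow]
  push_cast
  rcases Int.even_or_odd w with h | h
  · rw [h.neg_one_zpow, Even.neg_one_zpow]
    obtain ⟨k, hk⟩ := h
    exact ⟨p - k, by omega⟩
  · rw [h.neg_one_zpow, Odd.neg_one_zpow]
    obtain ⟨k, hk⟩ := h
    exact ⟨p - k - 1, by omega⟩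

open scoped MatrixOrder Matrix.Norms.L2Operator in
theorem exists_eq_transpose_mul_self {S : Matrix ι ι ℝ} (hS : S.PosDef) :
    ∃ R : Matrix ι ι ℝ, IsUnit R ∧ S = Rᵀ * R := by
  obtain ⟨y, hy, rfl⟩ :=
    CStarAlgebra.isStrictlyPositive_iff_eq_star_mul_self.mp hS.isStrictlyPositive
  exact ⟨y, hy, rfl⟩

end Polarization

/-! ### The group of a Hodge domain -/

section Group

variable {ι : Type*} [Fintype ι] [DecidableEq ι] (D : HodgeDomain ι)

/-- The elements of `𝔤` are infinitesimal isometries. -/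
theorem HodgeDomain.transpose_mul_add_mul_eq_zero {X : Matrix ι ι ℝ} (hX : X ∈ D.𝔤) :
    Xᵀ * D.Q + D.Q * X = 0 := by
  have hexp : ∀ t : ℝ, (NormedSpace.exp (t • X))ᵀ * D.Q = D.Q * NormedSpace.exp (t • -X) :=
    fun t => by
      obtain ⟨g, hg, hgt⟩ := (D.mem_𝔤 X).mp hX t
      have h1 := D.isometry g hg
      rw [hgt] at h1
      have h2 := congrArg (· * NormedSpace.exp (-(t • X))) h1
      rwa [mul_assoc, matrix_exp_mul_exp_neg, mul_one, ← smul_neg] at h2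
  ext a b
  let φ : Matrix ι ι ℝ →ₗ[ℝ] ℝ := Matrix.entryLinearMap ℝ ℝ a b ∘ₗ
    LinearMap.mulRight ℝ D.Q ∘ₗ (Matrix.transposeLinearEquiv ι ι ℝ ℝ).toLinearMap
  let ψ : Matrix ι ι ℝ →ₗ[ℝ] ℝ := Matrix.entryLinearMap ℝ ℝ a b ∘ₗ LinearMap.mulLeft ℝ D.Q
  have hφ : ∀ A, φ A = (Aᵀ * D.Q) a b := fun A => rfl
  have hψ : ∀ A, ψ A = (D.Q * A) a b := fun A => rfl
  have h1 := hasDerivAt_map_matrix_exp_smul φ X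
  have h2 := hasDerivAt_map_matrix_exp_smul ψ (-X)
  have h3 : (fun t : ℝ => φ (NormedSpace.exp (t • X))) =
      fun t : ℝ => ψ (NormedSpace.exp (t • -X)) := funext fun t => by rw [hφ, hψ, hexp]
  rw [h3] at h1
  have h4 := h1.unique h2
  rw [hφ, hψ] at h4
  rw [Matrix.add_apply, h4, mul_neg, Matrix.neg_apply, neg_add_cancel, Matrix.zero_apply]

theorem HodgeDomain.conj_mem_𝔤 {g : GL ι ℝ} (hg : g ∈ D.G) {X : Matrix ι ι ℝ} (hX : X ∈ D.𝔤) :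
    (g : Matrix ι ι ℝ) * X * ((g⁻¹ : GL ι ℝ) : Matrix ι ι ℝ) ∈ D.𝔤 := by
  rw [D.mem_𝔤]
  intro t
  obtain ⟨k, hk, hkt⟩ := (D.mem_𝔤 X).mp hX t
  refine ⟨g * k * g⁻¹, D.G.mul_mem (D.G.mul_mem hg hk) (D.G.inv_mem hg), ?_⟩
  have := Matrix.exp_units_conj g (t • X)
  rw [Units.val_mul, Units.val_mul, hkt, ← this, mul_smul_comm, smul_mul_assoc]

/-- Write the point as `g F₀`; then `c = g φ(i) g⁻¹` is its Weil operator. A real `P` preserving the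
Hodge filtration preserves each Hodge component, where `c` is a scalar, so the two commute. -/
theorem HodgeDomain.exists_posDef_of_mem_points {E : Matrix ι ι ℂ} {F : ℤ → Submodule ℂ (ι → ℂ)}
    {P : Matrix ι ι ℝ} (hF : ∀ p, ∀ v ∈ F p, cplx P *ᵥ v ∈ F p) (hE : Commute (cplx P) E)
    (h : translate E F ∈ D.points) :
    ∃ c ∈ D.G, Commute (c : Matrix ι ι ℝ) P ∧ ∃ S : Matrix ι ι ℝ, S.PosDef ∧
      S = (c : Matrix ι ι ℝ)ᵀ * D.Q := by
  obtain ⟨g, hg, hgF⟩ := h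
  obtain ⟨c, hc, hcF⟩ := D.circle Complex.I Complex.norm_I
  have htop := iSup_hodgeComponent_eq_top D.polarized.antitone D.polarized.exists_top
    D.polarized.exists_bot D.polarized.opposed
  set g' : Matrix ι ι ℝ := ((g⁻¹ : GL ι ℝ) : Matrix ι ι ℝ) with hg'def
  have hgg' : (g : Matrix ι ι ℝ) * g' = 1 := by rw [hg'def, ← Units.val_mul, mul_inv_cancel]; rfl
  have hg'g : g' * (g : Matrix ι ι ℝ) = 1 := by rw [hg'def, ← Units.val_mul, inv_mul_cancel]; rfl
  have h1c : cplx (1 : Matrix ι ι ℝ) = 1 := Matrix.map_one _ Complex.ofReal_zero Complex.ofReal_one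
  -- Transporting `P` to the base point `F₀` allows the circle to be used where it is given.
  set P₀ := g' * P * (g : Matrix ι ι ℝ) with hP₀def
  have hP₀ : ∀ p, ∀ v ∈ D.F₀ p, cplx P₀ *ᵥ v ∈ D.F₀ p := fun p v hv => by
    have h1 : cplx (g : Matrix ι ι ℝ) *ᵥ v ∈ translate E F p := by
      rw [hgF]
      exact ⟨v, hv, rfl⟩
    obtain ⟨u, hu, hug⟩ := h1
    rw [Matrix.mulVecLin_apply] at hug
    have h2 : E *ᵥ (cplx P *ᵥ u) ∈ translate E F p := ⟨_, hF p u hu, rfl⟩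
    rw [Matrix.mulVec_mulVec, ← hE.eq, ← Matrix.mulVec_mulVec, hug, hgF] at h2
    obtain ⟨x, hx, hxg⟩ := h2
    rw [Matrix.mulVecLin_apply] at hxg
    have h3 : cplx P₀ *ᵥ v = x := by
      rw [hP₀def, cplx_mul, cplx_mul, ← Matrix.mulVec_mulVec, ← Matrix.mulVec_mulVec, ← hxg,
        Matrix.mulVec_mulVec, ← cplx_mul, hg'g, h1c, Matrix.one_mulVec]
    rwa [h3]
  have hcP₀ : Commute (c : Matrix ι ι ℝ) P₀ := by
    refine commute_of_commute_cplx (eq_of_mulVec_eq_of_iSup_eq_top htop fun p v hv => ?_)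
    have hv' : cplx P₀ *ᵥ v ∈ hodgeComponent D.w D.F₀ p := by
      refine ⟨hP₀ p v hv.1, ?_⟩
      change star (cplx P₀ *ᵥ v) ∈ D.F₀ (D.w - p)
      rw [star_cplx_mulVec]
      exact hP₀ _ _ hv.2
    rw [← Matrix.mulVec_mulVec, ← Matrix.mulVec_mulVec, hcF p v hv, hcF p _ hv',
      Matrix.mulVec_smul]
  have hsymm : ((c : Matrix ι ι ℝ)ᵀ * D.Q)ᵀ = (c : Matrix ι ι ℝ)ᵀ * D.Q := by
    have h1 : (c : Matrix ι ι ℝ)ᵀ * D.Q * ((c : Matrix ι ι ℝ) * (c : Matrix ι ι ℝ)) =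
        D.Q * (c : Matrix ι ι ℝ) := by
      rw [← mul_assoc, D.isometry c hc]
    rw [weil_mul_self htop hcF, mul_smul_comm, mul_one] at h1
    have h2 : ((-1 : ℝ) ^ D.w) * ((-1 : ℝ) ^ D.w) = 1 := by
      rw [← mul_zpow]; norm_num
    rw [Matrix.transpose_mul, Matrix.transpose_transpose, D.parity, smul_mul_assoc, ← h1, smul_smul,
      h2, one_smul]
  have hpos : ((c : Matrix ι ι ℝ)ᵀ * D.Q).PosDef :=
    Matrix.PosDef.of_dotProduct_mulVec_pos hsymm fun v hv => by
      simpa using weilForm_pos D.polarized hcF hv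
  refine ⟨g * c * g⁻¹, D.G.mul_mem (D.G.mul_mem hg hc) (D.G.inv_mem hg), ?_, _,
    Matrix.PosDef.conjTranspose_mul_mul_same hpos (B := g') ?_, ?_⟩
  · have hP : P = (g : Matrix ι ι ℝ) * P₀ * g' := by
      calc P = ((g : Matrix ι ι ℝ) * g') * P * ((g : Matrix ι ι ℝ) * g') := by
            rw [hgg', one_mul, mul_one]
        _ = _ := by simp only [hP₀def, mul_assoc]
    have hmul : ∀ A B : Matrix ι ι ℝ, (g : Matrix ι ι ℝ) * A * g' * ((g : Matrix ι ι ℝ) * B * g') =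
        (g : Matrix ι ι ℝ) * (A * B) * g' := fun A B => by
      calc _ = (g : Matrix ι ι ℝ) * A * (g' * (g : Matrix ι ι ℝ)) * B * g' := by
            simp only [mul_assoc]
        _ = _ := by rw [hg'g, mul_one, mul_assoc (g : Matrix ι ι ℝ)]
    rw [Units.val_mul, Units.val_mul, ← hg'def, hP, commute_iff_eq, hmul, hmul, hcP₀.eq]
  · exact Matrix.mulVec_injective_of_isUnit (g⁻¹).isUnit
  · have h1 : (g : Matrix ι ι ℝ)ᵀ * D.Q = D.Q * g' := by
      have := congrArg (· * g') (D.isometry g hg)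
      rwa [mul_assoc, hgg', mul_one] at this
    simp only [Matrix.conjTranspose_eq_transpose_of_trivial, Units.val_mul, ← hg'def,
      Matrix.transpose_mul, mul_assoc, h1]

end Group

/-! ### The Cartan involution of `𝔪` given by a Weil operator. -/

section Main

variable {ι : Type*} [Fintype ι] [DecidableEq ι] {D : HodgeDomain ι} {m : ℕ}
  {F : ℤ → Submodule ℂ (ι → ℂ)} {N : Fin m → Matrix ι ι ℝ} {W : ℤ → Submodule ℝ (ι → ℝ)}
  {I : ℤ × ℤ → Submodule ℂ (ι → ℂ)} {T : Fin m → StandardTriple D.𝔤}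

/-- In suitable coordinates, the Levi algebra `𝔪` is closed under transposition. -/
theorem exists_conj_transpose_closed (hN : IsNilpotentOrbit D F N)
    (hW : IsConeWeightFiltration N W) (hI : IsRSplitBigrading F (shift D.w W) I)
    (hT : IsCKSSystem D N I T) :
    ∃ R R' : Matrix ι ι ℝ, R * R' = 1 ∧ R' * R = 1 ∧
      ∀ X ∈ D.𝔪 I, ∃ X' ∈ D.𝔪 I, R * X' * R' = (R * X * R')ᵀ := by
  obtain ⟨P, hP⟩ := hI.exists_circle_generator
  have hPF : ∀ p, ∀ v ∈ F p, cplx P *ᵥ v ∈ F p := fun p v hv => by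
    have hle : F p ≤ (F p).comap (cplx P).mulVecLin := by
      conv_lhs => rw [hI.hodge]
      refine iSup_le fun a u hu => ?_
      rw [Submodule.mem_comap, Matrix.mulVecLin_apply, hP a.1.1 a.1.2 u hu]
      refine Submodule.smul_mem _ _ ?_
      rw [hI.hodge]
      exact Submodule.mem_iSup_of_mem a hu
    exact hle hv
  obtain ⟨c, hc⟩ := hN.eventually_mem
  -- Any point far up the orbit serves; taking all `z_i = (c + 1) i` puts the imaginary parts just
  -- above the bound.
  have hmem := hc (fun _ => ((c + 1 : ℝ) : ℂ) * Complex.I) fun _ => by simp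
  obtain ⟨k, hk, hkP, S, hS, hSk⟩ := D.exists_posDef_of_mem_points hPF
    (Commute.exp_right (Commute.sum_right _ _ _ fun i _ =>
      (commute_cplx (commute_circle_generator_N hP hN hW hI i)).smul_right _)) hmem
  obtain ⟨R, hR, hSR⟩ := exists_eq_transpose_mul_self hS
  obtain ⟨u, rfl⟩ := hR
  set R : Matrix ι ι ℝ := (u : Matrix ι ι ℝ)
  set R' : Matrix ι ι ℝ := ((u⁻¹ : (Matrix ι ι ℝ)ˣ) : Matrix ι ι ℝ)
  set C : Matrix ι ι ℝ := (k : Matrix ι ι ℝ)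
  set C' : Matrix ι ι ℝ := ((k⁻¹ : GL ι ℝ) : Matrix ι ι ℝ)
  have hRR' : R * R' = 1 := u.mul_inv
  have hR'R : R' * R = 1 := u.inv_mul
  have hCC' : C * C' = 1 := k.mul_inv
  have hC'C : C' * C = 1 := k.inv_mul
  -- `-C X C⁻¹` is the adjoint of `X` for `S = Q C⁻¹`, because `Xᵀ Q = -Q X`. As `S = Rᵀ R`,
  -- conjugation by `R` turns this adjoint into the transpose.
  refine ⟨R, R', hRR', hR'R, fun X hX => ⟨-(C * X * C'), ?_, ?_⟩⟩
  · have hC'P : Commute C' P := by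
      rw [commute_iff_eq]
      calc C' * P = C' * (P * C) * C' := by rw [mul_assoc, mul_assoc, hCC', mul_one]
        _ = P * C' := by rw [← hkP.eq, ← mul_assoc, hC'C, one_mul]
    refine neg_mem (mem_𝔪_of_commute hP hI hT (D.conj_mem_𝔤 hk hX.1) ?_)
    exact (hkP.mul_left (commute_of_mem_𝔪 hP hI hX)).mul_left hC'P
  · have hCQ : Cᵀ * D.Q = D.Q * C' := by
      have := congrArg (· * C') (D.isometry k hk)
      rwa [mul_assoc, hCC', mul_one] at this
    have hXQ : Xᵀ * D.Q = -(D.Q * X) :=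
      eq_neg_of_add_eq_zero_left (D.transpose_mul_add_mul_eq_zero hX.1)
    have hRRS : Rᵀ * R = D.Q * C' := by rw [← hSR, hSk, hCQ]
    have hR'T : R'ᵀ * Rᵀ = 1 := by rw [← Matrix.transpose_mul, hRR', Matrix.transpose_one]
    have key : Rᵀ * (R * -(C * X * C')) = Xᵀ * Rᵀ * R := by
      calc Rᵀ * (R * -(C * X * C')) = -(D.Q * (C' * C) * X * C') := by
            rw [← mul_assoc, hRRS]; simp only [mul_neg, mul_assoc]
        _ = Xᵀ * (D.Q * C') := by rw [hC'C, mul_one, ← mul_assoc Xᵀ, hXQ, neg_mul]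
        _ = Xᵀ * Rᵀ * R := by rw [← hRRS, mul_assoc]
    calc R * -(C * X * C') * R' = R'ᵀ * Rᵀ * (R * -(C * X * C')) * R' := by
          rw [hR'T, one_mul]
      _ = R'ᵀ * (Xᵀ * Rᵀ * R) * R' := by rw [mul_assoc R'ᵀ, key]
      _ = R'ᵀ * (Xᵀ * Rᵀ) * (R * R') := by simp only [mul_assoc]
      _ = (R * X * R')ᵀ := by
          rw [hRR', mul_one, Matrix.transpose_mul, Matrix.transpose_mul]

/-- Conjugation by an invertible matrix, as a representation of a Lie algebra of matrices. -/
def conjRep (𝔪 : LieSubalgebra ℝ (Matrix ι ι ℝ)) {R R' : Matrix ι ι ℝ} (h : R' * R = 1) :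
    𝔪 →ₗ⁅ℝ⁆ Matrix ι ι ℝ where
  toFun X := R * (X : Matrix ι ι ℝ) * R'
  map_add' X Y := by simp [mul_add, add_mul]
  map_smul' c X := by simp
  map_lie' {X Y} := by
    have key : ∀ A B : Matrix ι ι ℝ, R * A * R' * (R * B * R') = R * (A * B) * R' := fun A B => by
      calc R * A * R' * (R * B * R') = R * A * (R' * R) * B * R' := by simp only [mul_assoc]
        _ = R * (A * B) * R' := by rw [h, mul_one, mul_assoc R]
    simp only [LieSubalgebra.coe_bracket, LieRing.of_associative_ring_bracket, key, mul_sub,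
      sub_mul]

theorem IsRealDiagonalizable.conj {A R R' : Matrix ι ι ℝ} (hA : IsRealDiagonalizable A)
    (hRR' : R * R' = 1) (hR'R : R' * R = 1) : IsRealDiagonalizable (R * A * R') := by
  obtain ⟨s, hs⟩ := hA.exists_aeval_eq_zero
  refine isRealDiagonalizable_of_aeval_eq_zero (s := s) ?_
  have h1 : R * A = R * A * R' * R := by rw [mul_assoc (R * A), hR'R, mul_one]
  have h2 := mul_aeval_eq_aeval_mul h1 (∏ μ ∈ s, (Polynomial.X - Polynomial.C μ))
  rw [hs, mul_zero] at h2
  rw [← mul_one (Polynomial.aeval _ _), ← hRR', ← mul_assoc, ← h2, zero_mul]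

end Main

end NilpotentCone

end

theorem lemma3p11 {ι : Type*} [Fintype ι] [DecidableEq ι]
    (D : NilpotentCone.HodgeDomain ι) {m : ℕ}
    (F : ℤ → Submodule ℂ (ι → ℂ)) (N : Fin m → Matrix ι ι ℝ)
    (hN : NilpotentCone.IsNilpotentOrbit D F N)
    (W : ℤ → Submodule ℝ (ι → ℝ)) (hW : NilpotentCone.IsConeWeightFiltration N W)
    (I : ℤ × ℤ → Submodule ℂ (ι → ℂ))
    (hI : NilpotentCone.IsRSplitBigrading F (NilpotentCone.shift D.w W) I)
    (T : Fin m → NilpotentCone.StandardTriple D.𝔤)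
    (hT : NilpotentCone.IsCKSSystem D N I T) :
    {j : Fin m | (T j).IsNontrivial}.ncard ≤ NilpotentCone.realRank (D.𝔪ss I) := by
  obtain ⟨P, hP⟩ := hI.exists_circle_generator
  have hPN := NilpotentCone.commute_circle_generator_N hP hN hW hI
  have hPY := NilpotentCone.commute_circle_generator_grading hP hI hT
  have hYN := hT.lie_grading_top_N hN hW hI
  have mem : ∀ x : D.𝔤, Commute P (x : Matrix ι ι ℝ) → (x : Matrix ι ι ℝ) ∈ D.𝔪 I := fun x hx =>
    NilpotentCone.mem_𝔪_of_commute hP hI hT x.2 hx.symm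
  have hpos := fun j => mem (T j).pos (hT.commute_pos hN.commute hPN hPY j)
  have hneut := fun j => mem (T j).neut (hT.commute_neut hN.commute hPN hPY j)
  have hneg := fun j => mem (T j).neg (hT.commute_neg_of_commute j (hPN j)
    (hT.commute_grading hN.commute hPN hPY j.2.le))
  obtain ⟨R, R', hRR', hR'R, htr⟩ := NilpotentCone.exists_conj_transpose_closed hN hW hI hT
  have hinj : Function.Injective (NilpotentCone.conjRep (D.𝔪 I) hR'R) := fun X Y hXY => by
    have h1 : R * (X : Matrix ι ι ℝ) * R' = R * (Y : Matrix ι ι ℝ) * R' := hXY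
    have h2 : ∀ A : Matrix ι ι ℝ, R' * (R * A * R') * R = A := fun A => by
      calc R' * (R * A * R') * R = (R' * R) * A * (R' * R) := by simp only [mul_assoc]
        _ = A := by rw [hR'R, one_mul, mul_one]
    exact Subtype.ext (by rw [← h2 X, h1, h2])
  have key := NilpotentCone.card_le_realRank_derived (NilpotentCone.conjRep (D.𝔪 I) hR'R) hinj
    (fun X => by
      obtain ⟨X', hX', h⟩ := htr X X.2
      exact ⟨⟨X', hX'⟩, h⟩)
    (H := fun j : {j : Fin m // (T j).IsNontrivial} =>
      (⟨((T j).neut : Matrix ι ι ℝ), hneut j⟩ : D.𝔪 I))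
    -- The neutral element is a bracket of two elements of `𝔪`; this is why the bound involves the
    -- derived algebra and not only `𝔪`.
    (fun j => by
      have : (⟨((T j).neut : Matrix ι ι ℝ), hneut j⟩ : D.𝔪 I) =
          ⁅(⟨((T j).pos : Matrix ι ι ℝ), hpos j⟩ : D.𝔪 I), ⟨((T j).neg : Matrix ι ι ℝ), hneg j⟩⁆ :=
        Subtype.ext (NilpotentCone.coe_lie_pos_neg (T j)).symm
      rw [this]
      exact LieSubmodule.lie_mem_lie trivial trivial)
    (fun i j => Subtype.ext (NilpotentCone.lie_eq_zero_iff_commute.mpr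
      (hT.commute_neut_neut hN.commute hYN i j)))
    (fun j => (hT.isRealDiagonalizable_neut j).conj hRR' hR'R)
    (LinearIndependent.of_comp (D.𝔪 I).toSubmodule.subtype
      (hT.linearIndependent_neut hN.commute hYN))
  exact key
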